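/- **Setting.** Let $\mathbb H$ be a separable complex reproducing kernel Hilbert space of functions on a compact space $E$ with continuous kernel $R$. Fix a complete orthonormal system $\{e_j\}$ of $\mathbb H$, and call $x\in\mathbb H$ real if all $\langle x,e_j\rangle$ are real. Write $(x\otimes y)z=\langle z,y\rangle x$, and let $\|\cdot\|_{\rm tr}$, $\|\cdot\|_{\rm HS}$ be the trace and Hilbert–Schmidt norms. Let $\{X(t),t\in\mathbb R^d\}$ be a zero-mean stationary Gaussian process with values in the real elements of $\mathbb H$, with covariance operator $C(h)=\mathbb E[X(t+h)\otimes X(t)]$ and spectral density $$f(\theta)=\frac1{(2\pi)^d}\int_{\mathbb R^d}e^{\mathrm i h^\top\theta}C(h)\,dh .$$ **Covariance.** Assume $\int\|C(h)\|_{\rm tr}\,dh<\infty$ and, for some $0<\gamma\le 1$, $M<\infty$ and all small $\delta>0$, $$\int_{\mathbb R^d}\sup_{\|y-x\|\le\delta}\|C(y)-C(x)\|_{\rm tr}\,dx\le M\delta^\gamma .$$ **Kernel.** Let $K:\mathbb R^d\to[0,\infty)$ be Lipschitz continuous, with $S_K=\{K>0\}$ bounded, $\sup K=K(0)=1$, and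 $K$ differentiable with bounded gradient in a neighbourhood of $0$. **Sampling.** Let $\mathbb T_n\subset\mathbb R^d$ be finite sets of locations, $T_n$ the convex hull of $\mathbb T_n$, $V(t)=\{x\in T_n:\|x-t\|\le\|x-s\|\ \forall s\in\mathbb T_n\}$ the Voronoi cells and $\delta_n=\max_{t\in\mathbb T_n}\sup_{x\in V(t)}\|x-t\|$. Assume $\delta_n\to0$, $|T_n|\to\infty$ and $T_n/|T_n|^{1/d}\to T$ in the Hausdorff metric for some bounded convex set $T$ with non-empty interior ($|\cdot|$ is Lebesgue measure). **Estimator.** For bandwidths $\Delta_n$ put $$\hat f_n(\theta)=\frac1{(2\pi)^d}\sum_{t,s\in\mathbb T_n}e^{\mathrm i(t-s)^\top\theta}\,\frac{X(t)\otimes X(s)}{|T_n\cap(T_n-(t-s))|}\,K\Big(\frac{t-s}{\Delta_n}\Big)|V(t)|\,|V(s)| .$$ Let $D_n=\{u_{n,1},\dots,u_{n,m_n}\}\subset E$ be such that the matrix $(R(u_{n,i},u_{n,j}))_{i,j}$ is invertible, let $\Pi_n$ be the orthogonal projection of $\mathbb H$ onto $\mathrm{span}\{R(u,\cdot):u\in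 D_n\}$, let $\tilde f_n(\theta)=\Pi_n\hat f_n(\theta)\Pi_n$, and let $\tilde f$ (which depends on $n$) be the spectral density of the projected process $\Pi_nX$. **Theorem.** Suppose that $\Delta_n\to\infty$, $\Delta_n^d/|T_n|\to0$ and $\Delta_n S_K\subset T_n-T_n$ for all large $n$. Then $\tilde f(\theta)=\Pi_nf(\theta)\Pi_n$ for all $n$ and $\theta$, and for every bounded set $\Theta\subset\mathbb R^d$, uniformly in $\theta\in\Theta$, $$\Big(\mathbb E\big\|\tilde f_n(\theta)-\tilde f(\theta)\big\|_{\rm HS}^2\Big)^{1/2}=\mathcal O\Big(\delta_n^\gamma+B_1(\Delta_n,\theta)+B_2(\Delta_n,\theta)+\sqrt{\Delta_n^d/|T_n|}\Big)\qquad(n\to\infty),$$ where $$B_1(\Delta,\theta)=\Big\|\int_{\Delta S_K}e^{\mathrm i h^\top\theta}\big(1-K(h/\Delta)\big)C(h)\,dh\Big\|_{\rm HS},\qquad B_2(\Delta,\theta)=\Big\|\int_{\mathbb R^d\setminus\Delta S_K}e^{\mathrm i h^\top\theta}C(h)\,dh\Big\|_{\rm HS}.$$ In particular the supremum over $\theta\in\Theta$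 of the left-hand side is of the order of the supremum over $\theta\in\Theta$ of the right-hand side. -/

import Mathlib

open MeasureTheory ProbabilityTheory Filter Topology
open scoped ENNReal NNReal Pointwise

noncomputable section

namespace SpectralRKHS

/-! ### Operators on a complex Hilbert space -/

section Operators

variable {H : Type*} [NormedAddCommGroup H] [InnerProductSpace ℂ H] [CompleteSpace H]
  {ι : Type*}

/-- The trace norm `∑ⱼ ⟨(T* T)^(1/2) eⱼ, eⱼ⟩`, valued in `[0, ∞]`. The value is the same for every
complete orthonormal system `b`; `T` is trace class iff it is finite. -/
def traceNorm (b : HilbertBasis ι ℂ H) (T : H →L[ℂ] H) : ℝ≥0∞ :=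
  ∑' j, ENNReal.ofReal (inner ℂ (CFC.abs T (b j)) (b j)).re

/-- The Hilbert-Schmidt norm `(∑ⱼ ‖T eⱼ‖²)^(1/2)`, valued in `[0, ∞]`. The value is the same for
every complete orthonormal system `b`. -/
def hsNorm (b : HilbertBasis ι ℂ H) (T : H →L[ℂ] H) : ℝ≥0∞ :=
  (∑' j, ‖T (b j)‖ₑ ^ 2) ^ (1 / 2 : ℝ)

/-- The compression `Q T Q`. -/
def compress (Q T : H →L[ℂ] H) : H →L[ℂ] H := Q ∘L T ∘L Q

/-- `x` is real with respect to the complete orthonormal system `b`: its coordinates are real,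
i.e. `x` is equal to its complex conjugate `∑ⱼ conj ⟨x, eⱼ⟩ eⱼ`. -/
def IsRealVector (b : HilbertBasis ι ℂ H) (x : H) : Prop :=
  ∀ j, (inner ℂ (b j) x).im = 0

end Operators

/-! ### Stationary processes, covariance and spectral density -/

section Processes

variable {d : ℕ} {H : Type*} [NormedAddCommGroup H] [InnerProductSpace ℂ H] [CompleteSpace H]
  {ι : Type*} {Ω : Type*} [MeasurableSpace Ω]

/-- The covariance operator `C(t, s) = E[X(t) ⊗ X(s)]`, where `(x ⊗ y) z = ⟨z, y⟩ x` (linear in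
`z`). -/
def covOp (P : Measure Ω) (X : EuclideanSpace ℝ (Fin d) → Ω → H)
    (t s : EuclideanSpace ℝ (Fin d)) : H →L[ℂ] H :=
  ∫ ω, InnerProductSpace.rankOne ℂ (X t ω) (X s ω) ∂P

/-- The stationary covariance operator `C(h) = C(h, 0)`. -/
def autocov (P : Measure Ω) (X : EuclideanSpace ℝ (Fin d) → Ω → H)
    (h : EuclideanSpace ℝ (Fin d)) : H →L[ℂ] H :=
  covOp P X h 0

/-- `X` is a zero-mean stationary Gaussian process, real with respect to `b`. As `X` is real, its
pseudo-covariance is its covariance. -/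
structure IsStationaryGaussian [MeasurableSpace H] (P : Measure Ω) (b : HilbertBasis ι ℂ H)
    (X : EuclideanSpace ℝ (Fin d) → Ω → H) : Prop where
  gaussian : IsGaussianProcess X P
  real : ∀ t, ∀ᵐ ω ∂P, IsRealVector b (X t ω)
  zero_mean : ∀ t, ∫ ω, X t ω ∂P = 0
  stationary : ∀ t h, covOp P X (t + h) t = autocov P X h

/-- The character `exp(i hᵀθ)`. -/
def character (θ h : EuclideanSpace ℝ (Fin d)) : ℂ :=
  Complex.exp (Complex.I * ((inner ℝ h θ : ℝ) : ℂ))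

/-- The spectral density `(2π)⁻ᵈ ∫ exp(i hᵀθ) C(h) dh` attached to a covariance function. -/
def spectralDensity (C : EuclideanSpace ℝ (Fin d) → H →L[ℂ] H)
    (θ : EuclideanSpace ℝ (Fin d)) : H →L[ℂ] H :=
  (((2 * Real.pi) ^ d)⁻¹ : ℂ) • ∫ h, character θ h • C h

/-- The oscillation `sup_{‖x - y‖ ≤ δ} ‖C(y) - C(x)‖_tr`. -/
def oscillation (b : HilbertBasis ι ℂ H) (C : EuclideanSpace ℝ (Fin d) → H →L[ℂ] H) (δ : ℝ)
    (x : EuclideanSpace ℝ (Fin d)) : ℝ≥0∞ :=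
  ⨆ y ∈ Metric.closedBall x δ, traceNorm b (C y - C x)

/-- The covariance is integrable and `L¹`-`γ`-Hölder in trace norm. The Hölder bound is asked at
all small scales. -/
structure CovarianceRegular (b : HilbertBasis ι ℂ H) (C : EuclideanSpace ℝ (Fin d) → H →L[ℂ] H)
    (γ : ℝ) : Prop where
  integrable : ∫⁻ h, traceNorm b (C h) < ∞
  holder : 0 < γ ∧ γ ≤ 1 ∧ ∃ M : ℝ, ∃ δ₀ : ℝ, 0 < δ₀ ∧ ∀ δ : ℝ, 0 < δ → δ ≤ δ₀ →
    AEMeasurable (oscillation b C δ) volume ∧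
      ∫⁻ x, oscillation b C δ x ≤ ENNReal.ofReal (M * δ ^ γ)

end Processes

/-! ### Sampling design -/

section Sampling

variable {d : ℕ}

/-- The sampling region: the convex hull (closed, the set being finite) of the locations. -/
def region (S : Finset (EuclideanSpace ℝ (Fin d))) : Set (EuclideanSpace ℝ (Fin d)) :=
  convexHull ℝ (S : Set (EuclideanSpace ℝ (Fin d)))

/-- The Voronoi cell of `t` in the sampling region. -/
def cell (S : Finset (EuclideanSpace ℝ (Fin d))) (t : EuclideanSpace ℝ (Fin d)) :
    Set (EuclideanSpace ℝ (Fin d)) :=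
  {x ∈ region S | ∀ s ∈ S, dist x t ≤ dist x s}

/-- The diameter `max_t sup_{x ∈ V(t)} ‖x - t‖` of the Voronoi tessellation. -/
def meshSize (S : Finset (EuclideanSpace ℝ (Fin d))) : ℝ :=
  sSup {r : ℝ | ∃ t ∈ S, ∃ x ∈ cell S t, r = dist x t}

/-- The mixed-domain sampling framework: the mesh size tends to `0`, the volume of the sampling
region tends to infinity, and the sampling region, normalized to volume one, tends in the Hausdorff
metric to a bounded convex set with non-empty interior. -/
structure SamplingDesign (S : ℕ → Finset (EuclideanSpace ℝ (Fin d))) : Prop where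
  mesh : Tendsto (fun n => meshSize (S n)) atTop (𝓝 0)
  volume_tendsto : Tendsto (fun n => volume.real (region (S n))) atTop atTop
  shape : ∃ T : Set (EuclideanSpace ℝ (Fin d)), Bornology.IsBounded T ∧ Convex ℝ T ∧
    (interior T).Nonempty ∧
    Tendsto (fun n => Metric.hausdorffDist
      (((volume.real (region (S n))) ^ (1 / d : ℝ))⁻¹ • region (S n)) T) atTop (𝓝 0)

/-- The set `S_K` where the kernel is positive. -/
def kernelSupport (K : EuclideanSpace ℝ (Fin d) → ℝ) : Set (EuclideanSpace ℝ (Fin d)) :=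
  {u | 0 < K u}

/-- The conditions on the smoothing kernel. -/
structure KernelRegular (K : EuclideanSpace ℝ (Fin d) → ℝ) : Prop where
  nonneg : ∀ u, 0 ≤ K u
  continuous : Continuous K
  bounded_support : Bornology.IsBounded (kernelSupport K)
  le_one : ∀ u, K u ≤ 1
  at_zero : K 0 = 1
  differentiable : ∃ ε : ℝ, 0 < ε ∧ ∃ L : ℝ, ∀ u ∈ Metric.ball 0 ε,
    DifferentiableAt ℝ K u ∧ ‖gradient K u‖ ≤ L
  lipschitz : ∃ L : ℝ≥0, LipschitzWith L K

variable {H : Type*} [NormedAddCommGroup H] [InnerProductSpace ℂ H] [CompleteSpace H]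
  {ι : Type*} {Ω : Type*} [MeasurableSpace Ω]

/-- The lag-window estimator
`(2π)⁻ᵈ ∑ₜ ∑ₛ exp(i (t-s)ᵀθ) X(t) ⊗ X(s) / |T ∩ (T - (t-s))| · K((t-s)/Δ) · |V(t)| |V(s)|`. -/
def estimator (X : EuclideanSpace ℝ (Fin d) → Ω → H) (S : Finset (EuclideanSpace ℝ (Fin d)))
    (K : EuclideanSpace ℝ (Fin d) → ℝ) (Δ : ℝ) (θ : EuclideanSpace ℝ (Fin d)) (ω : Ω) :
    H →L[ℂ] H :=
  (((2 * Real.pi) ^ d)⁻¹ : ℂ) • ∑ t ∈ S, ∑ s ∈ S,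
    (character θ (t - s) *
      ((K (Δ⁻¹ • (t - s)) * volume.real (cell S t) * volume.real (cell S s) /
        volume.real (region S ∩ (-(t - s) +ᵥ region S)) : ℝ) : ℂ)) •
      InnerProductSpace.rankOne ℂ (X t ω) (X s ω)

/-- `B₁`: the Hilbert-Schmidt norm of `∫_{h ∈ Δ S_K} exp(i hᵀθ) (1 - K(h/Δ)) C(h) dh`. -/
def biasB1 (b : HilbertBasis ι ℂ H) (C : EuclideanSpace ℝ (Fin d) → H →L[ℂ] H)
    (K : EuclideanSpace ℝ (Fin d) → ℝ) (Δ : ℝ) (θ : EuclideanSpace ℝ (Fin d)) : ℝ :=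
  (hsNorm b (∫ h in Δ • kernelSupport K,
    (character θ h * ((1 - K (Δ⁻¹ • h) : ℝ) : ℂ)) • C h)).toReal

/-- `B₂`: the Hilbert-Schmidt norm of `∫_{h ∉ Δ S_K} exp(i hᵀθ) C(h) dh`. -/
def biasB2 (b : HilbertBasis ι ℂ H) (C : EuclideanSpace ℝ (Fin d) → H →L[ℂ] H)
    (K : EuclideanSpace ℝ (Fin d) → ℝ) (Δ : ℝ) (θ : EuclideanSpace ℝ (Fin d)) : ℝ :=
  (hsNorm b (∫ h in (Δ • kernelSupport K)ᶜ, character θ h • C h)).toReal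

/-- The root mean square `(E ‖A‖²_HS)^(1/2)` of a random operator, valued in `[0, ∞]`. -/
def rootMeanSquare (P : Measure Ω) (b : HilbertBasis ι ℂ H) (A : Ω → H →L[ℂ] H) : ℝ≥0∞ :=
  (∫⁻ ω, hsNorm b (A ω) ^ 2 ∂P) ^ (1 / 2 : ℝ)

end Sampling

/-! ### Projection on the span of finitely many kernel functions -/

section Projection

variable {E : Type*} (H : Type*) [NormedAddCommGroup H] [InnerProductSpace ℂ H] [CompleteSpace H]
  [RKHS ℂ H E ℂ]

/-- The element `R(u, ·)` of `H` that represents the evaluation at `u`. -/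
def kernelSection (u : E) : H := RKHS.kerFun H u 1

/-- The reproducing kernel `R(u, v)`. -/
def reproducingKernel (u v : E) : ℂ := kernelSection H u v

/-- The matrix `(R(uᵢ, uⱼ))ᵢⱼ`. -/
def kernelMatrix {m : ℕ} (u : Fin m → E) : Matrix (Fin m) (Fin m) ℂ :=
  Matrix.of fun i j => reproducingKernel H (u i) (u j)

/-- The span of the functions `R(uⱼ, ·)`. -/
def observationSpace {m : ℕ} (u : Fin m → E) : Submodule ℂ H :=
  Submodule.span ℂ (Set.range fun j => kernelSection H (u j))

instance observationSpace_finiteDimensional {m : ℕ} (u : Fin m → E) :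
    FiniteDimensional ℂ (observationSpace H u) :=
  FiniteDimensional.span_of_finite ℂ (Set.finite_range _)

/-- The orthogonal projection of `H` onto the span of the functions `R(uⱼ, ·)`. -/
def observationProjection {m : ℕ} (u : Fin m → E) : H →L[ℂ] H :=
  (observationSpace H u).starProjection

end Projection

end SpectralRKHS

end

open SpectralRKHS

/-!
By Isserlis' formula the fourth-order cumulants of a Gaussian process vanish, so the variance of
the lag-window estimator is a sum of two kinds of products of covariances, one measured by
Hilbert-Schmidt norms and the other by the diagonals of the operators. Both norms are at most the
trace norm, and the number of pairs of locations within a bandwidth of each other gives the order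
`Δ ^ d / |T|`.

The expectation of the estimator is a Riemann sum, over pairs of Voronoi cells, of an integral over
`T × T`. Substituting the lag `h = x - y` turns this integral into one over `h` with the factor
`|T ∩ (T - h)|`, which the normalization of the estimator cancels. The `L¹`-Hölder condition bounds
the error of the Riemann sum by `δ ^ γ`, the overlaps being stable under small changes of the lag
because `T` is convex with an inradius that is large compared with the bandwidth. What is left is
the effect of the window `K (h / Δ)`, namely `B₁ + B₂`.

Finally, compression by the projection `Π` is a contraction in the Hilbert-Schmidt norm and
commutes with integration, so both bounds pass to the projected process.
-/

namespace SpectralRKHS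

open scoped InnerProduct

section HilbertBasis

variable {𝕜 H : Type*} [RCLike 𝕜] [NormedAddCommGroup H] [InnerProductSpace 𝕜 H] {ι : Type*}

theorem countable_index_of_hilbertBasis [TopologicalSpace.SeparableSpace H]
    (b : HilbertBasis ι 𝕜 H) : Countable ι := by
  refine Pairwise.countable_of_isOpen_disjoint (s := fun i => Metric.ball (b i) (1 / 2))
    (fun i j hij => Metric.ball_disjoint_ball ?_) (fun i => Metric.isOpen_ball)
    (fun i => ⟨b i, Metric.mem_ball_self one_half_pos⟩)
  have norm_sq : ‖b i - b j‖ ^ 2 = 2 := by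
    rw [@norm_sub_sq 𝕜, b.orthonormal.2 hij, b.orthonormal.1 i, b.orthonormal.1 j, map_zero]
    norm_num
  rw [dist_eq_norm]
  nlinarith [norm_nonneg (b i - b j)]

theorem enorm_inner_le (x y : H) : ‖inner 𝕜 x y‖ₑ ≤ ‖x‖ₑ * ‖y‖ₑ := by
  simp only [enorm]
  exact_mod_cast nnnorm_inner_le_nnnorm (𝕜 := 𝕜) x y

theorem tsum_enorm_inner_sq (b : HilbertBasis ι 𝕜 H) (x : H) :
    ∑' j, ‖inner 𝕜 (b j) x‖ₑ ^ 2 = ‖x‖ₑ ^ 2 := by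
  have parseval : HasSum (fun j => ‖inner 𝕜 (b j) x‖ ^ 2) (‖x‖ ^ 2) := by
    have h := (b.hasSum_inner_mul_inner x x).mapL (RCLike.reCLM (K := 𝕜))
    simpa only [RCLike.reCLM_apply, inner_mul_symm_re_eq_norm, norm_mul, norm_inner_symm x, ← sq,
      inner_self_eq_norm_sq] using h
  simp_rw [← ofReal_norm, ← ENNReal.ofReal_pow (norm_nonneg _)]
  rw [← ENNReal.ofReal_tsum_of_nonneg (fun _ => by positivity) parseval.summable, parseval.tsum_eq]

end HilbertBasis

theorem tsum_mul_le_sqrt_mul_sqrt {κ : Type*} (f g : κ → ℝ≥0∞) :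
    ∑' i, f i * g i ≤ (∑' i, f i ^ 2) ^ (1 / 2 : ℝ) * (∑' i, g i ^ 2) ^ (1 / 2 : ℝ) := by
  rw [ENNReal.tsum_eq_iSup_sum, iSup_le_iff]
  intro J
  refine (ENNReal.inner_le_Lp_mul_Lq J f g Real.HolderConjugate.two_two).trans ?_
  gcongr
  · simpa using ENNReal.sum_le_tsum (f := fun i => f i ^ 2) J
  · simpa using ENNReal.sum_le_tsum (f := fun i => g i ^ 2) J

section HilbertSchmidt

variable {H : Type*} [NormedAddCommGroup H] [InnerProductSpace ℂ H] {ι : Type*}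
  (b : HilbertBasis ι ℂ H)

theorem hsNorm_sq (T : H →L[ℂ] H) : hsNorm b T ^ 2 = ∑' j, ‖T (b j)‖ₑ ^ 2 := by
  rw [hsNorm, ← ENNReal.rpow_natCast, ← ENNReal.rpow_mul]
  norm_num

theorem hsNorm_sq_eq_tsum_inner (T : H →L[ℂ] H) :
    hsNorm b T ^ 2 = ∑' j, ∑' k, ‖inner ℂ (b k) (T (b j))‖ₑ ^ 2 := by
  simp_rw [hsNorm_sq, tsum_enorm_inner_sq]

theorem hsNorm_congr_norm {S T : H →L[ℂ] H} (h : ∀ x, ‖S x‖ = ‖T x‖) :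
    hsNorm b S = hsNorm b T := by
  simp only [hsNorm, ← ofReal_norm, h]

theorem hsNorm_zero : hsNorm b 0 = 0 := by
  simp [hsNorm]

theorem hsNorm_neg (T : H →L[ℂ] H) : hsNorm b (-T) = hsNorm b T := by
  simp [hsNorm]

theorem hsNorm_comp_le_left (A T : H →L[ℂ] H) : hsNorm b (A ∘L T) ≤ ‖A‖ₑ * hsNorm b T := by
  rw [← ENNReal.pow_le_pow_left_iff two_ne_zero, mul_pow, hsNorm_sq, hsNorm_sq,
    ← ENNReal.tsum_mul_left]
  refine ENNReal.tsum_le_tsum fun j => ?_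
  rw [← mul_pow]
  gcongr
  exact A.le_opENorm _

theorem hsNorm_smul_le (a : ℂ) (T : H →L[ℂ] H) : hsNorm b (a • T) ≤ ‖a‖ₑ * hsNorm b T := by
  rw [← ENNReal.pow_le_pow_left_iff two_ne_zero, mul_pow, hsNorm_sq, hsNorm_sq,
    ← ENNReal.tsum_mul_left]
  simp only [smul_apply, enorm_smul, mul_pow, le_refl]

/-- The truncation `T ↦ (T eⱼ)_{j ∈ J}`. The Hilbert-Schmidt norm is the supremum of the norms of
these continuous maps into Hilbert spaces, which is how it inherits the triangle inequality for sums
and integrals. -/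
noncomputable def hsTruncation (J : Finset ι) : (H →L[ℂ] H) →L[ℂ] PiLp 2 (fun _ : J => H) :=
  (PiLp.continuousLinearEquiv 2 ℂ (fun _ : J => H)).symm.toContinuousLinearMap ∘L
    ContinuousLinearMap.pi fun j : J => ContinuousLinearMap.apply ℂ H (b j)

theorem enorm_hsTruncation_sq (J : Finset ι) (T : H →L[ℂ] H) :
    ‖hsTruncation b J T‖ₑ ^ 2 = ∑ j ∈ J, ‖T (b j)‖ₑ ^ 2 := by
  rw [← ofReal_norm, ← ENNReal.ofReal_pow (norm_nonneg _), PiLp.norm_sq_eq_of_L2,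
    ENNReal.ofReal_sum_of_nonneg (fun _ _ => by positivity), ← Finset.sum_coe_sort J]
  refine Finset.sum_congr rfl fun j _ => ?_
  rw [ENNReal.ofReal_pow (norm_nonneg _), ofReal_norm]
  rfl

theorem hsNorm_le_iff_forall_hsTruncation (T : H →L[ℂ] H) (c : ℝ≥0∞) :
    hsNorm b T ≤ c ↔ ∀ J, ‖hsTruncation b J T‖ₑ ≤ c := by
  simp_rw [← ENNReal.pow_le_pow_left_iff (a := hsNorm b T) two_ne_zero, hsNorm_sq,
    ENNReal.tsum_eq_iSup_sum, iSup_le_iff, ← enorm_hsTruncation_sq,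
    ENNReal.pow_le_pow_left_iff two_ne_zero]

theorem enorm_hsTruncation_le (J : Finset ι) (T : H →L[ℂ] H) :
    ‖hsTruncation b J T‖ₑ ≤ hsNorm b T :=
  (hsNorm_le_iff_forall_hsTruncation b T _).1 le_rfl J

theorem hsNorm_add_le (S T : H →L[ℂ] H) : hsNorm b (S + T) ≤ hsNorm b S + hsNorm b T := by
  rw [hsNorm_le_iff_forall_hsTruncation]
  intro J
  rw [map_add]
  exact (enorm_add_le _ _).trans
    (add_le_add (enorm_hsTruncation_le b J S) (enorm_hsTruncation_le b J T))

theorem hsNorm_sum_le {κ : Type*} (s : Finset κ) (T : κ → H →L[ℂ] H) :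
    hsNorm b (∑ i ∈ s, T i) ≤ ∑ i ∈ s, hsNorm b (T i) :=
  Finset.le_sum_of_subadditive _ (hsNorm_zero b).le (hsNorm_add_le b) s T

theorem hsNorm_integral_le {α : Type*} [MeasurableSpace α] [CompleteSpace H] (μ : Measure α)
    (F : α → H →L[ℂ] H) : hsNorm b (∫ a, F a ∂μ) ≤ ∫⁻ a, hsNorm b (F a) ∂μ := by
  by_cases hF : Integrable F μ
  · rw [hsNorm_le_iff_forall_hsTruncation]
    intro J
    rw [← ContinuousLinearMap.integral_comp_comm _ hF]
    exact (enorm_integral_le_lintegral_enorm _).trans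
      (lintegral_mono fun a => enorm_hsTruncation_le b J (F a))
  · rw [integral_undef hF, hsNorm_zero]
    exact bot_le

variable [CompleteSpace H]

theorem hsNorm_adjoint (T : H →L[ℂ] H) : hsNorm b (T†) = hsNorm b T := by
  refine (ENNReal.pow_right_strictMono two_ne_zero).injective ?_
  simp only [hsNorm_sq_eq_tsum_inner]
  rw [ENNReal.tsum_comm]
  refine tsum_congr fun j => tsum_congr fun k => ?_
  rw [ContinuousLinearMap.adjoint_inner_right, ← inner_conj_symm, RCLike.enorm_conj]

theorem hsNorm_comp_le_right (T A : H →L[ℂ] H) : hsNorm b (T ∘L A) ≤ hsNorm b T * ‖A‖ₑ := by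
  rw [← hsNorm_adjoint, ContinuousLinearMap.adjoint_comp, ← hsNorm_adjoint b T, mul_comm]
  refine (hsNorm_comp_le_left b _ _).trans_eq ?_
  rw [← ofReal_norm, LinearIsometryEquiv.norm_map, ofReal_norm]

theorem hsNorm_compress_le {Q : H →L[ℂ] H} (hQ : ‖Q‖ₑ ≤ 1) (T : H →L[ℂ] H) :
    hsNorm b (compress Q T) ≤ hsNorm b T :=
  calc hsNorm b (compress Q T) ≤ ‖Q‖ₑ * hsNorm b (T ∘L Q) := hsNorm_comp_le_left b _ _
    _ ≤ ‖Q‖ₑ * (hsNorm b T * ‖Q‖ₑ) := by gcongr; exact hsNorm_comp_le_right b T Q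
    _ ≤ 1 * (hsNorm b T * 1) := by gcongr
    _ = hsNorm b T := by rw [one_mul, mul_one]

theorem enorm_le_hsNorm (T : H →L[ℂ] H) : ‖T‖ₑ ≤ hsNorm b T := by
  rw [← hsNorm_adjoint]
  refine ContinuousLinearMap.opENorm_le_bound _ fun x => ?_
  rw [← ENNReal.pow_le_pow_left_iff two_ne_zero, mul_pow, hsNorm_sq, ← tsum_enorm_inner_sq b,
    ← ENNReal.tsum_mul_right]
  refine ENNReal.tsum_le_tsum fun j => ?_
  rw [← mul_pow, ← ContinuousLinearMap.adjoint_inner_left]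
  gcongr
  exact enorm_inner_le _ _

end HilbertSchmidt

section TraceNorm

/-- Douglas' factorization lemma. -/
theorem exists_comp_eq_of_norm_apply_le {𝕜 E F G : Type*} [RCLike 𝕜]
    [NormedAddCommGroup E] [NormedSpace 𝕜 E] [NormedAddCommGroup F] [InnerProductSpace 𝕜 F]
    [CompleteSpace F] [NormedAddCommGroup G] [NormedSpace 𝕜 G] [CompleteSpace G]
    (T : E →L[𝕜] G) (A : E →L[𝕜] F) (hTA : ∀ x, ‖T x‖ ≤ ‖A x‖) :
    ∃ W : F →L[𝕜] G, ‖W‖ ≤ 1 ∧ W ∘L A = T := by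
  let D := A.range.topologicalClosure
  let e : E →ₗ[𝕜] D := A.toLinearMap.codRestrict D fun x =>
    A.range.le_topologicalClosure (LinearMap.mem_range_self _ x)
  have dense_range : DenseRange e := by
    rw [DenseRange, Subtype.dense_iff]
    intro y hy
    rwa [← Set.range_comp]
  have norm_le : ∀ x, ‖T.toLinearMap x‖ ≤ 1 * ‖e x‖ := fun x => by
    rw [one_mul]
    exact hTA x
  refine ⟨T.toLinearMap.extendOfNorm e ∘L D.orthogonalProjectionOnto, ?_, ?_⟩
  · refine (ContinuousLinearMap.opNorm_comp_le _ _).trans (mul_le_one₀ ?_ (norm_nonneg _) ?_)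
    · exact LinearMap.opNorm_extendOfNorm_le dense_range zero_le_one norm_le
    · exact D.orthogonalProjectionOnto_norm_le
  · ext x
    have proj : D.orthogonalProjectionOnto (A x) = e x :=
      D.orthogonalProjectionOnto_mem_subspace_eq_self (e x)
    simpa [proj] using LinearMap.extendOfNorm_eq dense_range ⟨1, norm_le⟩ x

variable {H : Type*} [NormedAddCommGroup H] [InnerProductSpace ℂ H] {ι : Type*}
  (b : HilbertBasis ι ℂ H)

/-- The `ℓ¹` norm `∑ⱼ |⟨T eⱼ, eⱼ⟩|` of the diagonal. It depends on the basis, but is dominated by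
the trace norm. -/
noncomputable def diagNorm (T : H →L[ℂ] H) : ℝ≥0∞ :=
  ∑' j, ‖inner ℂ (b j) (T (b j))‖ₑ

theorem diagNorm_add_le (S T : H →L[ℂ] H) :
    diagNorm b (S + T) ≤ diagNorm b S + diagNorm b T := by
  rw [diagNorm, diagNorm, diagNorm, ← ENNReal.tsum_add]
  refine ENNReal.tsum_le_tsum fun j => ?_
  rw [add_apply, inner_add_right]
  exact enorm_add_le _ _

/-- The sum of the Hilbert-Schmidt norm and the diagonal norm. By Isserlis' formula the variance of
a quadratic form in the process only involves the covariance operators through these two norms. -/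
noncomputable def crossNorm (T : H →L[ℂ] H) : ℝ≥0∞ :=
  hsNorm b T + diagNorm b T

theorem crossNorm_add_le (S T : H →L[ℂ] H) :
    crossNorm b (S + T) ≤ crossNorm b S + crossNorm b T :=
  (add_le_add (hsNorm_add_le b S T) (diagNorm_add_le b S T)).trans_eq (add_add_add_comm _ _ _ _)

variable [CompleteSpace H]

theorem diagNorm_comp_le (S T : H →L[ℂ] H) : diagNorm b (S ∘L T) ≤ hsNorm b S * hsNorm b T :=
  calc diagNorm b (S ∘L T)
      ≤ ∑' j, ‖(S†) (b j)‖ₑ * ‖T (b j)‖ₑ := by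
        refine ENNReal.tsum_le_tsum fun j => ?_
        rw [ContinuousLinearMap.comp_apply, ← ContinuousLinearMap.adjoint_inner_left]
        exact enorm_inner_le _ _
    _ ≤ hsNorm b (S†) * hsNorm b T := tsum_mul_le_sqrt_mul_sqrt _ _
    _ = hsNorm b S * hsNorm b T := by rw [hsNorm_adjoint]

theorem norm_abs_apply (T : H →L[ℂ] H) (x : H) : ‖CFC.abs T x‖ = ‖T x‖ := by
  have abs_adjoint : (CFC.abs T)† = CFC.abs T := (CFC.abs_nonneg T).isSelfAdjoint.star_eq
  have inner_eq : inner ℂ (CFC.abs T x) (CFC.abs T x) = inner ℂ (T x) (T x) := by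
    rw [← ContinuousLinearMap.adjoint_inner_right, abs_adjoint, ← mul_apply_eq_comp,
      CFC.abs_mul_abs, mul_apply_eq_comp, ContinuousLinearMap.star_eq_adjoint,
      ContinuousLinearMap.adjoint_inner_right]
  rw [inner_self_eq_norm_sq_to_K, inner_self_eq_norm_sq_to_K] at inner_eq
  exact (sq_eq_sq₀ (norm_nonneg _) (norm_nonneg _)).1 (by exact_mod_cast inner_eq)

theorem sqrt_abs_comp_sqrt_abs (T : H →L[ℂ] H) :
    CFC.sqrt (CFC.abs T) ∘L CFC.sqrt (CFC.abs T) = CFC.abs T :=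
  CFC.sqrt_mul_sqrt_self _ (CFC.abs_nonneg T)

theorem traceNorm_eq_hsNorm_sqrt_abs_sq (T : H →L[ℂ] H) :
    traceNorm b T = hsNorm b (CFC.sqrt (CFC.abs T)) ^ 2 := by
  have sqrt_adjoint : (CFC.sqrt (CFC.abs T))† = CFC.sqrt (CFC.abs T) :=
    (CFC.sqrt_nonneg (CFC.abs T)).isSelfAdjoint.star_eq
  rw [hsNorm_sq, traceNorm]
  refine tsum_congr fun j => ?_
  nth_rw 1 [← sqrt_abs_comp_sqrt_abs T]
  rw [ContinuousLinearMap.comp_apply, ← ContinuousLinearMap.adjoint_inner_right, sqrt_adjoint,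
    inner_self_eq_norm_sq_to_K, ← ofReal_norm, ← ENNReal.ofReal_pow (norm_nonneg _)]
  norm_cast

theorem hsNorm_le_traceNorm (T : H →L[ℂ] H) : hsNorm b T ≤ traceNorm b T := by
  rw [← hsNorm_congr_norm b (norm_abs_apply T), traceNorm_eq_hsNorm_sqrt_abs_sq, sq]
  nth_rw 1 [← sqrt_abs_comp_sqrt_abs]
  exact (hsNorm_comp_le_left b _ _).trans (by gcongr; exact enorm_le_hsNorm b _)

theorem enorm_le_traceNorm (T : H →L[ℂ] H) : ‖T‖ₑ ≤ traceNorm b T :=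
  (enorm_le_hsNorm b T).trans (hsNorm_le_traceNorm b T)

theorem diagNorm_le_traceNorm (T : H →L[ℂ] H) : diagNorm b T ≤ traceNorm b T := by
  obtain ⟨W, norm_W, polar⟩ :=
    exists_comp_eq_of_norm_apply_le T (CFC.abs T) fun x => (norm_abs_apply T x).ge
  have enorm_W : ‖W‖ₑ ≤ 1 := by rwa [← ofReal_norm, ENNReal.ofReal_le_one]
  set B := CFC.sqrt (CFC.abs T) with hB
  calc diagNorm b T = diagNorm b ((W ∘L B) ∘L B) := by
        rw [ContinuousLinearMap.comp_assoc, hB, sqrt_abs_comp_sqrt_abs, polar]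
    _ ≤ hsNorm b (W ∘L B) * hsNorm b B := diagNorm_comp_le b _ _
    _ ≤ 1 * hsNorm b B * hsNorm b B := by
        gcongr
        exact (hsNorm_comp_le_left b W B).trans (by gcongr)
    _ = traceNorm b T := by rw [one_mul, ← sq, traceNorm_eq_hsNorm_sqrt_abs_sq]

theorem crossNorm_le_two_mul_traceNorm (T : H →L[ℂ] H) : crossNorm b T ≤ 2 * traceNorm b T := by
  rw [two_mul]
  exact add_le_add (hsNorm_le_traceNorm b T) (diagNorm_le_traceNorm b T)

end TraceNorm

theorem enorm_complex_ofReal (x : ℝ) : ‖(x : ℂ)‖ₑ = ‖x‖ₑ := by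
  simp [enorm]

section GaussianMoments

theorem integral_pow_add_two_gaussianReal (v : ℝ≥0) (n : ℕ) :
    ∫ x, x ^ (n + 2) ∂gaussianReal 0 v = (n + 1) * v * ∫ x, x ^ n ∂gaussianReal 0 v := by
  set g : ℝ → ℝ := mgf id (gaussianReal 0 v) with hg
  have moment_eq (k : ℕ) : ∫ x, x ^ k ∂gaussianReal 0 v = iteratedDeriv k g 0 := by
    rw [hg, iteratedDeriv_mgf_zero (by simp) k]
    rfl
  have g_eq : g = fun t => Real.exp (v * t ^ 2 / 2) := by
    simp only [hg, mgf_id_gaussianReal, zero_mul, zero_add]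
  have smooth_g : ContDiff ℝ (n + 1) g := by rw [g_eq]; fun_prop
  have deriv_g : deriv g = fun t => v * (t * g t) := by
    ext t
    have h : HasDerivAt (fun t : ℝ => (v : ℝ) * t ^ 2 / 2) (v * t) t :=
      (((hasDerivAt_pow 2 t).const_mul (v : ℝ)).div_const 2).congr_deriv (by push_cast; ring)
    rw [g_eq, h.exp.deriv]
    ring
  rw [moment_eq, moment_eq, iteratedDeriv_succ', deriv_g, iteratedDeriv_const_mul_field,
    iteratedDeriv_fun_mul (by fun_prop) (by exact_mod_cast smooth_g.contDiffAt),
    Finset.sum_eq_single 1]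
  · simp only [iteratedDeriv_fun_id_zero, ↓reduceIte, Nat.choose_one_right, Nat.cast_add,
      Nat.cast_one, mul_one, add_tsub_cancel_right]
    ring
  · intro i _ hi
    simp [iteratedDeriv_fun_id_zero, hi]
  · simp

variable {Ω : Type*} [MeasurableSpace Ω] {P : Measure Ω}

theorem integral_pow_four_of_gaussian {Y : Ω → ℝ} (hY : HasGaussianLaw Y P)
    (h0 : ∫ ω, Y ω ∂P = 0) : ∫ ω, Y ω ^ 4 ∂P = 3 * (∫ ω, Y ω ^ 2 ∂P) ^ 2 := by
  have := hY.isProbabilityMeasure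
  have integral_pow (k : ℕ) :
      ∫ ω, Y ω ^ k ∂P = ∫ x, x ^ k ∂gaussianReal 0 Var[Y; P].toNNReal := by
    rw [← integral_map hY.aemeasurable (continuous_pow k).aestronglyMeasurable,
      hY.map_eq_gaussianReal, h0]
  rw [integral_pow, integral_pow, integral_pow_add_two_gaussianReal,
    integral_pow_add_two_gaussianReal _ 0]
  simp only [Real.coe_toNNReal _ (variance_nonneg _ _), pow_zero, integral_const, probReal_univ,
    smul_eq_mul, Nat.cast_ofNat, Nat.cast_zero]
  ring

theorem integral_sum_mul_sum {𝕜 κ : Type*} [RCLike 𝕜] (I : Finset κ) (a c : κ → 𝕜)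
    {U V : κ → Ω → 𝕜} (hUV : ∀ i ∈ I, ∀ j ∈ I, Integrable (fun ω => U i ω * V j ω) P) :
    ∫ ω, (∑ i ∈ I, a i * U i ω) * (∑ j ∈ I, c j * V j ω) ∂P =
      ∑ i ∈ I, ∑ j ∈ I, a i * c j * ∫ ω, U i ω * V j ω ∂P := by
  have integrable_term (i) (hi : i ∈ I) (j) (hj : j ∈ I) :
      Integrable (fun ω => a i * c j * (U i ω * V j ω)) P := (hUV i hi j hj).const_mul _
  simp_rw [Finset.sum_mul_sum, mul_mul_mul_comm (a _)]
  rw [integral_finsetSum _ fun i hi => integrable_finsetSum _ (integrable_term i hi)]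
  refine Finset.sum_congr rfl fun i hi => ?_
  rw [integral_finsetSum _ (integrable_term i hi)]
  exact Finset.sum_congr rfl fun j _ => integral_const_mul _ _

/-- The eight sign vectors in `ℝ⁴` with first entry `1`, which polarize the product of four
numbers into fourth powers. -/
def signVector (e : Fin 2 × Fin 2 × Fin 2) : Fin 4 → ℝ :=
  ![1, (-1) ^ (e.1 : ℕ), (-1) ^ (e.2.1 : ℕ), (-1) ^ (e.2.2 : ℕ)]

theorem sum_signVector_mul_pow_four (x : Fin 4 → ℝ) :
    ∑ e, (∏ i, signVector e i) * (∑ i, signVector e i * x i) ^ 4 =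
      192 * (x 0 * x 1 * x 2 * x 3) := by
  simp only [signVector, Fintype.sum_prod_type, Fin.sum_univ_two, Fin.sum_univ_four,
    Fin.prod_univ_four, Fin.isValue,
    Matrix.cons_val_zero, Matrix.cons_val_one, Matrix.cons_val,
    Fin.coe_ofNat_eq_mod, Nat.zero_mod, Nat.mod_succ, pow_zero, pow_one, one_mul, mul_one, neg_mul,
    mul_neg, neg_neg]
  ring

theorem sum_signVector_mul_quadratic_sq {G : Fin 4 → Fin 4 → ℝ} (hG : ∀ i j, G i j = G j i) :
    ∑ e, (∏ i, signVector e i) * (∑ i, ∑ j, signVector e i * signVector e j * G i j) ^ 2 =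
      64 * (G 0 1 * G 2 3 + G 0 2 * G 1 3 + G 0 3 * G 1 2) := by
  simp only [hG 1 0, hG 2 0, hG 3 0, hG 2 1, hG 3 1, hG 3 2, signVector, Fintype.sum_prod_type,
    Fin.sum_univ_two, Fin.sum_univ_four, Fin.prod_univ_four, Fin.isValue,
    Matrix.cons_val_zero, Matrix.cons_val_one, Matrix.cons_val,
    Fin.coe_ofNat_eq_mod, Nat.zero_mod, Nat.mod_succ, pow_zero, pow_one, one_mul, mul_one, neg_mul,
    mul_neg, neg_neg]
  ring

/-- Isserlis' formula. -/
theorem integral_mul_four_of_gaussian {Z : Fin 4 → Ω → ℝ} (hZ : IsGaussianProcess Z P)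
    (h0 : ∀ i, ∫ ω, Z i ω ∂P = 0) :
    ∫ ω, Z 0 ω * Z 1 ω * Z 2 ω * Z 3 ω ∂P =
      (∫ ω, Z 0 ω * Z 1 ω ∂P) * (∫ ω, Z 2 ω * Z 3 ω ∂P) +
      (∫ ω, Z 0 ω * Z 2 ω ∂P) * (∫ ω, Z 1 ω * Z 3 ω ∂P) +
      (∫ ω, Z 0 ω * Z 3 ω ∂P) * (∫ ω, Z 1 ω * Z 2 ω ∂P) := by
  have gaussian_coord (i) : HasGaussianLaw (Z i) P := hZ.hasGaussianLaw_eval i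
  have gaussian_sum (e : Fin 4 → ℝ) : HasGaussianLaw (fun ω => ∑ i, e i * Z i ω) P :=
    (hZ.smul e).hasGaussianLaw_fun_sum
  have centered (e : Fin 4 → ℝ) : ∫ ω, ∑ i, e i * Z i ω ∂P = 0 := by
    rw [integral_finsetSum _ fun i _ => (gaussian_coord i).integrable.const_mul _]
    simp [integral_const_mul, h0]
  have fourth_moment (e : Fin 4 → ℝ) : ∫ ω, (∑ i, e i * Z i ω) ^ 4 ∂P =
      3 * (∑ i, ∑ j, e i * e j * ∫ ω, Z i ω * Z j ω ∂P) ^ 2 := by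
    rw [integral_pow_four_of_gaussian (gaussian_sum e) (centered e), ← integral_sum_mul_sum _ _ _
      fun i _ j _ => (gaussian_coord i).memLp_two.integrable_mul (gaussian_coord j).memLp_two]
    simp_rw [sq]
  have integrable_fourth (e : Fin 4 → ℝ) : Integrable (fun ω => (∑ i, e i * Z i ω) ^ 4) P := by
    simpa [Even.pow_abs (show Even 4 by decide)] using
      ((gaussian_sum e).memLp (p := 4) (by norm_num)).integrable_norm_pow (by norm_num)
  have polarized : 192 * ∫ ω, Z 0 ω * Z 1 ω * Z 2 ω * Z 3 ω ∂P =
      ∑ e, (∏ i, signVector e i) * ∫ ω, (∑ i, signVector e i * Z i ω) ^ 4 ∂P := by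
    simp_rw [← integral_const_mul]
    rw [← integral_finsetSum _ fun e _ => (integrable_fourth _).const_mul _]
    simp_rw [sum_signVector_mul_pow_four fun i => Z i _]
  have paired := sum_signVector_mul_quadratic_sq (G := fun i j => ∫ ω, Z i ω * Z j ω ∂P)
    fun i j => by simp only [mul_comm]
  simp_rw [fourth_moment, mul_left_comm _ (3 : ℝ), ← Finset.mul_sum, paired] at polarized
  linarith

theorem memLp_mul_of_gaussian {T : Type*} {Y : T → Ω → ℝ} (hY : IsGaussianProcess Y P) (s t : T) :
    MemLp (fun ω => Y s ω * Y t ω) 2 P := by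
  have holder : ENNReal.HolderTriple 4 4 2 := ⟨by
    rw [← two_mul, show (4 : ℝ≥0∞) = 2 * 2 by norm_num, ENNReal.mul_inv (by simp) (by simp),
      ENNReal.mul_inv_cancel_left (by simp) (by simp)]⟩
  have memLp_four (t) : MemLp (Y t) 4 P := (hY.hasGaussianLaw_eval t).memLp (by norm_num)
  exact (memLp_four t).mul (memLp_four s)

theorem covariance_mul_mul_of_gaussian {T : Type*} {Y : T → Ω → ℝ} (hY : IsGaussianProcess Y P)
    (h0 : ∀ t, ∫ ω, Y t ω ∂P = 0) (s t s' t' : T) :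
    cov[fun ω => Y s ω * Y t ω, fun ω => Y s' ω * Y t' ω; P] =
      (∫ ω, Y s ω * Y s' ω ∂P) * (∫ ω, Y t ω * Y t' ω ∂P) +
      (∫ ω, Y s ω * Y t' ω ∂P) * (∫ ω, Y t ω * Y s' ω ∂P) := by
  have := hY.isProbabilityMeasure
  have isserlis := integral_mul_four_of_gaussian (hY.comp_right ![s, t, s', t']) fun i => h0 _
  rw [covariance_eq_sub (memLp_mul_of_gaussian hY s t) (memLp_mul_of_gaussian hY s' t')]
  simp only [Function.comp_apply, Matrix.cons_val, mul_assoc, Pi.mul_apply] at isserlis ⊢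
  linarith

theorem lintegral_enorm_sum_sq_le {κ : Type*} (I : Finset κ) (a : κ → ℂ) (U : κ → Ω → ℝ)
    (hU : ∀ i ∈ I, MemLp (U i) 2 P) :
    ∫⁻ ω, ‖∑ i ∈ I, a i * (U i ω : ℂ)‖ₑ ^ 2 ∂P ≤
      ∑ i ∈ I, ∑ j ∈ I, ‖a i‖ₑ * ‖a j‖ₑ * ‖∫ ω, U i ω * U j ω ∂P‖ₑ := by
  set f : Ω → ℂ := fun ω => ∑ i ∈ I, a i * (U i ω : ℂ)
  have conj_f (ω) : starRingEnd ℂ (f ω) = ∑ j ∈ I, starRingEnd ℂ (a j) * (U j ω : ℂ) := by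
    simp [f, map_sum]
  have second_moment : ∫ ω, ((‖f ω‖ ^ 2 : ℝ) : ℂ) ∂P =
      ∑ i ∈ I, ∑ j ∈ I, a i * starRingEnd ℂ (a j) * (∫ ω, U i ω * U j ω ∂P : ℝ) := by
    have integrable_mul (i) (hi : i ∈ I) (j) (hj : j ∈ I) :
        Integrable (fun ω => (U i ω : ℂ) * (U j ω : ℂ)) P := by
      exact_mod_cast ((hU i hi).integrable_mul (hU j hj)).ofReal (𝕜 := ℂ)
    simp_rw [Complex.ofReal_pow, ← Complex.mul_conj', conj_f, ← integral_complex_ofReal,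
      Complex.ofReal_mul]
    exact integral_sum_mul_sum I a _ integrable_mul
  have memLp_f : MemLp f 2 P := memLp_finsetSum _ fun i hi => (hU i hi).ofReal.const_mul (a i)
  calc ∫⁻ ω, ‖f ω‖ₑ ^ 2 ∂P = ENNReal.ofReal (∫ ω, ‖f ω‖ ^ 2 ∂P) := by
        rw [ofReal_integral_eq_lintegral_ofReal (memLp_f.integrable_norm_pow (by norm_num))
          (ae_of_all _ fun ω => by positivity)]
        simp_rw [ENNReal.ofReal_pow (norm_nonneg _), ofReal_norm]
    _ ≤ ‖∫ ω, ((‖f ω‖ ^ 2 : ℝ) : ℂ) ∂P‖ₑ := by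
        rw [integral_complex_ofReal, ← ofReal_norm, Complex.norm_real]
        exact ENNReal.ofReal_le_ofReal (le_abs_self _)
    _ ≤ _ := by
        rw [second_moment]
        refine (enorm_sum_le _ _).trans (Finset.sum_le_sum fun i _ => ?_)
        refine (enorm_sum_le _ _).trans (Finset.sum_le_sum fun j _ => ?_)
        rw [enorm_mul, enorm_mul, RCLike.enorm_conj, enorm_complex_ofReal]

end GaussianMoments

theorem tsum_enorm_inner_mul_inner_le {H ι : Type*} [NormedAddCommGroup H]
    [InnerProductSpace ℂ H] (b : HilbertBasis ι ℂ H) (S T : H →L[ℂ] H) :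
    ∑' j, ∑' k, ‖inner ℂ (b k) (S (b j))‖ₑ * ‖inner ℂ (b j) (T (b k))‖ₑ ≤
      hsNorm b S * hsNorm b T := by
  have hsNorm_eq (A : H →L[ℂ] H) :
      hsNorm b A = (∑' p : ι × ι, ‖inner ℂ (b p.2) (A (b p.1))‖ₑ ^ 2) ^ (1 / 2 : ℝ) := by
    rw [ENNReal.tsum_prod (f := fun j k => ‖inner ℂ (b k) (A (b j))‖ₑ ^ 2),
      ← hsNorm_sq_eq_tsum_inner, ← ENNReal.rpow_natCast, ← ENNReal.rpow_mul]
    norm_num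
  have hsNorm_eq_swap (A : H →L[ℂ] H) :
      hsNorm b A = (∑' p : ι × ι, ‖inner ℂ (b p.1) (A (b p.2))‖ₑ ^ 2) ^ (1 / 2 : ℝ) := by
    rw [hsNorm_eq, ← (Equiv.prodComm ι ι).tsum_eq]
    rfl
  rw [hsNorm_eq S, hsNorm_eq_swap T, ← ENNReal.tsum_prod
    (f := fun j k => ‖inner ℂ (b k) (S (b j))‖ₑ * ‖inner ℂ (b j) (T (b k))‖ₑ)]
  exact tsum_mul_le_sqrt_mul_sqrt _ _

section GaussianProcess

variable {d : ℕ} {H : Type*} [NormedAddCommGroup H] [InnerProductSpace ℂ H] {ι : Type*}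

/-- The functional `x ↦ Re ⟨x, e_j⟩`, the coordinate of a real element `x`. -/
noncomputable def realCoord (b : HilbertBasis ι ℂ H) (j : ι) : H →L[ℝ] ℝ :=
  Complex.reCLM ∘L (innerSL ℂ (b j)).restrictScalars ℝ

theorem inner_eq_realCoord {b : HilbertBasis ι ℂ H} {x : H} (hx : IsRealVector b x) (j : ι) :
    inner ℂ (b j) x = (realCoord b j x : ℂ) :=
  Complex.ext rfl (by simpa using hx j)

theorem inner_rankOne_eq_realCoord {b : HilbertBasis ι ℂ H} {x y : H} (hx : IsRealVector b x)
    (hy : IsRealVector b y) (j k : ι) :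
    inner ℂ (b k) (InnerProductSpace.rankOne ℂ x y (b j)) =
      ((realCoord b k x * realCoord b j y : ℝ) : ℂ) := by
  rw [InnerProductSpace.rankOne_apply, inner_smul_right, inner_eq_realCoord hx, ← inner_conj_symm,
    inner_eq_realCoord hy, Complex.conj_ofReal, mul_comm, Complex.ofReal_mul]

/-- The coordinate process `(j, t) ↦ Re ⟨X(t), e_j⟩` of an `H`-valued process. -/
noncomputable def coordProcess {T Ω : Type*} (b : HilbertBasis ι ℂ H) (X : T → Ω → H) (p : ι × T)
    (ω : Ω) : ℝ :=
  realCoord b p.1 (X p.2 ω)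

variable [MeasurableSpace H] [BorelSpace H] [TopologicalSpace.SeparableSpace H]
  {Ω : Type*} [MeasurableSpace Ω] {P : Measure Ω}
  {X : EuclideanSpace ℝ (Fin d) → Ω → H} {b : HilbertBasis ι ℂ H}

theorem isGaussianProcess_coordProcess {T : Type*} {X : T → Ω → H} (hX : IsGaussianProcess X P)
    (b : HilbertBasis ι ℂ H) : IsGaussianProcess (coordProcess b X) P :=
  hX.of_isGaussianProcess fun p =>
    ⟨{p.2}, realCoord b p.1 ∘L ContinuousLinearMap.proj ⟨p.2, by simp⟩, fun _ => rfl⟩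

variable [CompleteSpace H]

namespace IsStationaryGaussian

theorem integrable_rankOne (hX : IsStationaryGaussian P b X) (t s : EuclideanSpace ℝ (Fin d)) :
    Integrable (fun ω => InnerProductSpace.rankOne ℂ (X t ω) (X s ω)) P := by
  have := UniformSpace.secondCountable_of_separable H
  have memLp_two (t) : MemLp (X t) 2 P := (hX.gaussian.hasGaussianLaw_eval t).memLp_two
  have continuous_rankOne : Continuous fun p : H × H => InnerProductSpace.rankOne ℂ p.1 p.2 :=
    (ContinuousLinearMap.smulRightL ℂ H H).continuous₂.comp
      (((innerSL ℂ).continuous.comp continuous_snd).prodMk continuous_fst)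
  have measurable_rankOne := continuous_rankOne.comp_aestronglyMeasurable
    ((memLp_two t).aestronglyMeasurable.prodMk (memLp_two s).aestronglyMeasurable)
  refine ((memLp_two t).norm.integrable_mul (memLp_two s).norm).mono' measurable_rankOne
    (ae_of_all _ fun ω => ?_)
  exact (InnerProductSpace.norm_rankOne _ _).le

theorem integral_coordProcess (hX : IsStationaryGaussian P b X)
    (p : ι × EuclideanSpace ℝ (Fin d)) : ∫ ω, coordProcess b X p ω ∂P = 0 := by
  have := UniformSpace.secondCountable_of_separable H
  have integrable_X := (hX.gaussian.hasGaussianLaw_eval p.2).integrable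
  exact ((realCoord b p.1).integral_comp_comm integrable_X).trans (by rw [hX.zero_mean, map_zero])

theorem inner_autocov (hX : IsStationaryGaussian P b X) (t s : EuclideanSpace ℝ (Fin d))
    (j k : ι) :
    inner ℂ (b k) (autocov P X (t - s) (b j)) =
      ((∫ ω, coordProcess b X (k, t) ω * coordProcess b X (j, s) ω ∂P : ℝ) : ℂ) := by
  have covOp_eq : covOp P X t s = autocov P X (t - s) := by
    simpa using hX.stationary s (t - s)
  rw [← covOp_eq, covOp, ← integral_complex_ofReal]
  refine (((innerSL ℂ (b k)) ∘L (ContinuousLinearMap.apply ℂ H (b j))).integral_comp_comm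
    (hX.integrable_rankOne t s)).symm.trans (integral_congr_ae ?_)
  filter_upwards [hX.real t, hX.real s] with ω ht hs
  exact inner_rankOne_eq_realCoord ht hs j k

theorem enorm_covariance_coordProcess_le (hX : IsStationaryGaussian P b X)
    (t s t' s' : EuclideanSpace ℝ (Fin d)) (j k : ι) :
    ‖cov[fun ω => coordProcess b X (k, t) ω * coordProcess b X (j, s) ω,
        fun ω => coordProcess b X (k, t') ω * coordProcess b X (j, s') ω; P]‖ₑ ≤
      ‖inner ℂ (b k) (autocov P X (t - t') (b k))‖ₑ *
        ‖inner ℂ (b j) (autocov P X (s - s') (b j))‖ₑ +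
      ‖inner ℂ (b k) (autocov P X (t - s') (b j))‖ₑ *
        ‖inner ℂ (b j) (autocov P X (s - t') (b k))‖ₑ := by
  simp_rw [hX.inner_autocov, enorm_complex_ofReal]
  rw [covariance_mul_mul_of_gaussian (isGaussianProcess_coordProcess hX.gaussian b)
    hX.integral_coordProcess, ← enorm_mul, ← enorm_mul]
  exact enorm_add_le _ _

variable {κ : Type*} (I : Finset κ) (τ σ : κ → EuclideanSpace ℝ (Fin d)) (a : κ → ℂ)

theorem ae_inner_sum_smul_rankOne_sub_autocov (hX : IsStationaryGaussian P b X) :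
    ∀ᵐ ω ∂P, ∀ j k, inner ℂ (b k) ((∑ p ∈ I, a p •
        (InnerProductSpace.rankOne ℂ (X (τ p) ω) (X (σ p) ω) - autocov P X (τ p - σ p))) (b j)) =
      ∑ p ∈ I, a p * ((coordProcess b X (k, τ p) ω * coordProcess b X (j, σ p) ω -
        ∫ ω', coordProcess b X (k, τ p) ω' * coordProcess b X (j, σ p) ω' ∂P : ℝ) : ℂ) := by
  have real : ∀ᵐ ω ∂P, ∀ p ∈ I, IsRealVector b (X (τ p) ω) ∧ IsRealVector b (X (σ p) ω) :=
    (Filter.eventually_all_finset I).2 fun p _ => (hX.real _).and (hX.real _)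
  filter_upwards [real] with ω hω j k
  rw [sum_apply, inner_sum]
  refine Finset.sum_congr rfl fun p hp => ?_
  rw [smul_apply, inner_smul_right, sub_apply, inner_sub_right, hX.inner_autocov,
    inner_rankOne_eq_realCoord (hω p hp).1 (hω p hp).2, Complex.ofReal_sub]
  rfl

theorem lintegral_enorm_sum_centered_sq_le (hX : IsStationaryGaussian P b X) (j k : ι) :
    ∫⁻ ω, ‖∑ p ∈ I, a p * ((coordProcess b X (k, τ p) ω * coordProcess b X (j, σ p) ω -
        ∫ ω', coordProcess b X (k, τ p) ω' * coordProcess b X (j, σ p) ω' ∂P : ℝ) : ℂ)‖ₑ ^ 2 ∂P ≤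
      ∑ p ∈ I, ∑ q ∈ I, ‖a p‖ₑ * ‖a q‖ₑ *
        (‖inner ℂ (b k) (autocov P X (τ p - τ q) (b k))‖ₑ *
          ‖inner ℂ (b j) (autocov P X (σ p - σ q) (b j))‖ₑ +
        ‖inner ℂ (b k) (autocov P X (τ p - σ q) (b j))‖ₑ *
          ‖inner ℂ (b j) (autocov P X (σ p - τ q) (b k))‖ₑ) := by
  have := hX.gaussian.isProbabilityMeasure
  refine (lintegral_enorm_sum_sq_le I a _ fun p _ => (memLp_mul_of_gaussian
    (isGaussianProcess_coordProcess hX.gaussian b) (k, τ p) (j, σ p)).sub (memLp_const _)).trans ?_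
  gcongr with p _ q _
  exact hX.enorm_covariance_coordProcess_le _ _ _ _ j k

/-- The fourth-order cumulants of a Gaussian process vanish, which leaves only the two products of
covariances. -/
theorem lintegral_hsNorm_sq_le (hX : IsStationaryGaussian P b X) :
    ∫⁻ ω, hsNorm b (∑ p ∈ I, a p • (InnerProductSpace.rankOne ℂ (X (τ p) ω) (X (σ p) ω) -
        autocov P X (τ p - σ p))) ^ 2 ∂P ≤
      ∑ p ∈ I, ∑ q ∈ I, ‖a p‖ₑ * ‖a q‖ₑ *
        (diagNorm b (autocov P X (τ p - τ q)) * diagNorm b (autocov P X (σ p - σ q)) +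
          hsNorm b (autocov P X (τ p - σ q)) * hsNorm b (autocov P X (σ p - τ q))) := by
  have := countable_index_of_hilbertBasis b
  have measurable_coord (p) : AEMeasurable (coordProcess b X p) P :=
    (isGaussianProcess_coordProcess hX.gaussian b).aemeasurable p
  calc ∫⁻ ω, hsNorm b (∑ p ∈ I, a p • (InnerProductSpace.rankOne ℂ (X (τ p) ω) (X (σ p) ω) -
        autocov P X (τ p - σ p))) ^ 2 ∂P
      = ∫⁻ ω, ∑' j, ∑' k, ‖∑ p ∈ I, a p *
          ((coordProcess b X (k, τ p) ω * coordProcess b X (j, σ p) ω -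
            ∫ ω', coordProcess b X (k, τ p) ω' * coordProcess b X (j, σ p) ω' ∂P : ℝ) : ℂ)‖ₑ ^ 2
          ∂P := by
        refine lintegral_congr_ae ?_
        filter_upwards [hX.ae_inner_sum_smul_rankOne_sub_autocov I τ σ a] with ω hω
        simp_rw [hsNorm_sq_eq_tsum_inner, hω]
    _ = ∑' j, ∑' k, ∫⁻ ω, ‖∑ p ∈ I, a p *
          ((coordProcess b X (k, τ p) ω * coordProcess b X (j, σ p) ω -
            ∫ ω', coordProcess b X (k, τ p) ω' * coordProcess b X (j, σ p) ω' ∂P : ℝ) : ℂ)‖ₑ ^ 2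
          ∂P := by
        rw [lintegral_tsum fun j => AEMeasurable.tsum fun k => by fun_prop]
        exact tsum_congr fun j => lintegral_tsum fun k => by fun_prop
    _ ≤ ∑' j, ∑' k, ∑ p ∈ I, ∑ q ∈ I, ‖a p‖ₑ * ‖a q‖ₑ *
          (‖inner ℂ (b k) (autocov P X (τ p - τ q) (b k))‖ₑ *
            ‖inner ℂ (b j) (autocov P X (σ p - σ q) (b j))‖ₑ +
          ‖inner ℂ (b k) (autocov P X (τ p - σ q) (b j))‖ₑ *
            ‖inner ℂ (b j) (autocov P X (σ p - τ q) (b k))‖ₑ) :=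
        ENNReal.tsum_le_tsum fun j => ENNReal.tsum_le_tsum fun k =>
          hX.lintegral_enorm_sum_centered_sq_le I τ σ a j k
    _ ≤ _ := by
        simp_rw [Summable.tsum_finsetSum (fun _ _ => ENNReal.summable), ENNReal.tsum_mul_left,
          ENNReal.tsum_add]
        gcongr with p _ q _
        · simp_rw [ENNReal.tsum_mul_right, ENNReal.tsum_mul_left]
          rfl
        · exact tsum_enorm_inner_mul_inner_le b _ _

end IsStationaryGaussian

end GaussianProcess

section Overlap

variable {E : Type*} [AddCommGroup E] {T : Set E}

theorem mem_neg_vadd_iff {k x : E} : x ∈ -k +ᵥ T ↔ x + k ∈ T := by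
  rw [Set.mem_vadd_set_iff_neg_vadd_mem, neg_neg, vadd_eq_add, add_comm]

/-- The volume of the overlap of `T` and its translate `T - k`. -/
noncomputable def overlap [MeasurableSpace E] (μ : Measure E) (T : Set E) (k : E) : ℝ :=
  μ.real (T ∩ (-k +ᵥ T))

theorem overlap_nonneg [MeasurableSpace E] (μ : Measure E) (T : Set E) (k : E) :
    0 ≤ overlap μ T k :=
  measureReal_nonneg

/-- What the overlap loses in passing from `h` to `k` lies in a translate of the part of `T`
outside `T - (k - h)`. -/
theorem overlap_sub_overlap_le [MeasurableSpace E] [MeasurableAdd E] (μ : Measure E)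
    [μ.IsAddLeftInvariant] (hT : MeasurableSet T) (finite_volume : μ T ≠ ∞) (h k : E) :
    overlap μ T h - overlap μ T k ≤ μ.real T - overlap μ T (k - h) := by
  have finite_translate (v : E) : μ (v +ᵥ T) ≠ ∞ := by rwa [measure_vadd]
  have overlap_le : overlap μ T h ≤ overlap μ T k + μ.real ((-h +ᵥ T) \ (-k +ᵥ T)) := by
    refine (measureReal_mono (s₂ := (T ∩ (-k +ᵥ T)) ∪ ((-h +ᵥ T) \ (-k +ᵥ T))) ?_ ?_).trans
      (measureReal_union_le _ _)
    · rintro x ⟨hx, hxh⟩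
      by_cases hxk : x ∈ -k +ᵥ T
      · exact Or.inl ⟨hx, hxk⟩
      · exact Or.inr ⟨hxh, hxk⟩
    · exact measure_union_ne_top (measure_ne_top_of_subset Set.inter_subset_left finite_volume)
        (measure_ne_top_of_subset Set.sdiff_subset (finite_translate _))
  have translate_sdiff : (-h +ᵥ T) \ (-k +ᵥ T) = -h +ᵥ (T \ (-(k - h) +ᵥ T)) := by
    rw [Set.vadd_set_sdiff, vadd_vadd]
    congr 2
    abel
  have sdiff_volume : overlap μ T (k - h) + μ.real (T \ (-(k - h) +ᵥ T)) = μ.real T :=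
    measureReal_inter_add_sdiff (hT.const_vadd _) finite_volume
  rw [translate_sdiff, measureReal_def, measure_vadd, ← measureReal_def] at overlap_le
  linarith

end Overlap

theorem homothety_add_mem_of_convex {E : Type*} [NormedAddCommGroup E] [NormedSpace ℝ E] {T : Set E}
    (hT : Convex ℝ T) {z k y : E} {R ε : ℝ} (hz : Metric.closedBall z R ⊆ T) (hε : 0 ≤ ε)
    (hε1 : ε ≤ 1) (hk : ‖k‖ ≤ ε * R) (hy : y ∈ T) : AffineMap.homothety z (1 - ε) y + k ∈ T := by
  rcases hε.eq_or_lt with rfl | hpos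
  · have k_eq_zero : k = 0 := by simpa using hk
    simpa [k_eq_zero] using hy
  · have shifted_centre_mem : z + ε⁻¹ • k ∈ T := by
      apply hz
      rwa [mem_closedBall_iff_norm, add_sub_cancel_left, norm_smul, norm_inv,
        Real.norm_of_nonneg hε, inv_mul_le_iff₀ hpos]
    convert hT hy shifted_centre_mem (sub_nonneg.2 hε1) hε (sub_add_cancel 1 ε) using 1
    rw [AffineMap.homothety_apply, vsub_eq_sub, vadd_eq_add, smul_add, smul_inv_smul₀ hpos.ne']
    module

section ConvexOverlap

variable {E : Type*} [NormedAddCommGroup E] [NormedSpace ℝ E] [FiniteDimensional ℝ E]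
  [MeasurableSpace E] [BorelSpace E] (μ : Measure E) [μ.IsAddHaarMeasure] {T : Set E}

theorem one_sub_pow_mul_le_overlap (hT : Convex ℝ T) (hTc : IsCompact T) {z k : E} {R ε : ℝ}
    (hz : Metric.closedBall z R ⊆ T) (hε : 0 ≤ ε) (hε1 : ε ≤ 1) (hk : ‖k‖ ≤ ε * R) :
    (1 - ε) ^ Module.finrank ℝ E * μ.real T ≤ overlap μ T k := by
  have homothety_volume : μ.real (AffineMap.homothety z (1 - ε) '' T) =
      (1 - ε) ^ Module.finrank ℝ E * μ.real T := by
    rw [measureReal_def, Measure.addHaar_image_homothety, ENNReal.toReal_mul,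
      ENNReal.toReal_ofReal (abs_nonneg _), abs_of_nonneg (pow_nonneg (sub_nonneg.2 hε1) _),
      measureReal_def]
  have homothety_subset : AffineMap.homothety z (1 - ε) '' T ⊆ T ∩ (-k +ᵥ T) := by
    rintro _ ⟨y, hy, rfl⟩
    refine ⟨?_, mem_neg_vadd_iff.2 (homothety_add_mem_of_convex hT hz hε hε1 hk hy)⟩
    rw [← add_zero (AffineMap.homothety z (1 - ε) y)]
    refine homothety_add_mem_of_convex hT hz hε hε1 ?_ hy
    rw [norm_zero]
    exact (norm_nonneg k).trans hk
  rw [← homothety_volume]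
  exact measureReal_mono homothety_subset
    (measure_ne_top_of_subset Set.inter_subset_left hTc.measure_ne_top)

theorem abs_overlap_sub_overlap_le (hT : Convex ℝ T) (hTc : IsCompact T) {z h k : E} {R : ℝ}
    (hz : Metric.closedBall z R ⊆ T) (hR : 0 < R) (hhk : ‖h - k‖ ≤ R) :
    |overlap μ T h - overlap μ T k| ≤ Module.finrank ℝ E * (‖h - k‖ / R) * μ.real T := by
  have one_sided (h k : E) (hhk : ‖h - k‖ ≤ R) :
      overlap μ T h - overlap μ T k ≤ Module.finrank ℝ E * (‖h - k‖ / R) * μ.real T := by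
    have ratio_le_one : ‖h - k‖ / R ≤ 1 := (div_le_one hR).2 hhk
    have overlap_ge := one_sub_pow_mul_le_overlap μ (k := k - h) hT hTc hz (by positivity)
      ratio_le_one (by rw [div_mul_cancel₀ _ hR.ne', norm_sub_rev])
    have bernoulli : 1 - Module.finrank ℝ E * (‖h - k‖ / R) ≤
        (1 - ‖h - k‖ / R) ^ Module.finrank ℝ E := by
      simpa [sub_eq_add_neg] using
        one_add_mul_le_pow (a := -(‖h - k‖ / R)) (by linarith) (Module.finrank ℝ E)
    have volume_nonneg : 0 ≤ μ.real T := measureReal_nonneg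
    have sub_le := overlap_sub_overlap_le μ hTc.isClosed.measurableSet hTc.measure_ne_top h k
    nlinarith [mul_le_mul_of_nonneg_right bernoulli volume_nonneg]
  refine abs_sub_le_iff.2 ⟨one_sided h k hhk, ?_⟩
  rw [norm_sub_rev] at hhk ⊢
  exact one_sided k h hhk

end ConvexOverlap

/-- If `p ∉ A`, the point of `T` at distance `r` from `p` in the direction of a functional that
separates `p` from `A` is farther than `r` from `A`. -/
theorem closedBall_subset_of_hausdorffDist_lt {E : Type*} [NormedAddCommGroup E]
    [InnerProductSpace ℝ E] [CompleteSpace E] {A T : Set E} (hA : Convex ℝ A) (hAc : IsClosed A)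
    (hAb : Bornology.IsBounded A) (hAn : A.Nonempty) (hT : Bornology.IsBounded T) {z : E} {r : ℝ}
    (hr : 0 < r) (hz : Metric.closedBall z (2 * r) ⊆ T) (hd : Metric.hausdorffDist A T < r) :
    Metric.closedBall z r ⊆ A := by
  intro p hp
  by_contra hpA
  obtain ⟨f, u, hfA, hfp⟩ := geometric_hahn_banach_closed_point hA hAc hpA
  obtain ⟨v, rfl⟩ := (InnerProductSpace.toDual ℝ E).surjective f
  simp only [InnerProductSpace.toDual_apply_apply] at hfA hfp
  have v_ne_zero : v ≠ 0 := by
    rintro rfl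
    obtain ⟨a, ha⟩ := hAn
    have := hfA a ha
    simp only [inner_zero_left] at this hfp
    linarith
  have hv : 0 < ‖v‖ := norm_pos_iff.2 v_ne_zero
  have shifted_mem : p + (r / ‖v‖) • v ∈ T := by
    apply hz
    rw [mem_closedBall_iff_norm] at hp ⊢
    calc ‖p + (r / ‖v‖) • v - z‖ = ‖(p - z) + (r / ‖v‖) • v‖ := by congr 1; abel
      _ ≤ ‖p - z‖ + ‖(r / ‖v‖) • v‖ := norm_add_le _ _
      _ ≤ r + r := by
          gcongr
          rw [norm_smul, Real.norm_of_nonneg (by positivity), div_mul_cancel₀ _ hv.ne']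
      _ = 2 * r := by ring
  obtain ⟨a, ha, dist_lt⟩ := Metric.exists_dist_lt_of_hausdorffDist_lt' shifted_mem hd
    (Metric.hausdorffEDist_ne_top_of_nonempty_of_bounded hAn ⟨_, shifted_mem⟩ hAb hT)
  have inner_eq : inner ℝ v (p + (r / ‖v‖) • v - a) = inner ℝ v p - inner ℝ v a + r * ‖v‖ := by
    rw [inner_sub_right, inner_add_right, inner_smul_right, real_inner_self_eq_norm_sq]
    field_simp
    ring
  have inner_le : inner ℝ v (p + (r / ‖v‖) • v - a) ≤ ‖v‖ * r := by
    refine (real_inner_le_norm _ _).trans ?_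
    gcongr
    rw [← dist_eq_norm, dist_comm]
    exact dist_lt.le
  have := hfA a ha
  nlinarith

section Sampling

variable {d : ℕ}

theorem isCompact_region (S : Finset (EuclideanSpace ℝ (Fin d))) : IsCompact (region S) :=
  S.finite_toSet.isCompact_convexHull ℝ

theorem convex_region (S : Finset (EuclideanSpace ℝ (Fin d))) : Convex ℝ (region S) :=
  convex_convexHull ℝ _

theorem measurableSet_region (S : Finset (EuclideanSpace ℝ (Fin d))) : MeasurableSet (region S) :=
  (isCompact_region S).isClosed.measurableSet

theorem cell_subset_region (S : Finset (EuclideanSpace ℝ (Fin d)))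
    (t : EuclideanSpace ℝ (Fin d)) : cell S t ⊆ region S := fun _ hx => hx.1

theorem measurableSet_cell (S : Finset (EuclideanSpace ℝ (Fin d)))
    (t : EuclideanSpace ℝ (Fin d)) : MeasurableSet (cell S t) := by
  have cell_eq : cell S t = region S ∩ ⋂ s ∈ S, {x | dist x t ≤ dist x s} := by
    ext x
    simp [cell]
  rw [cell_eq]
  exact (measurableSet_region S).inter
    (isClosed_biInter fun s _ => isClosed_le (by fun_prop) (by fun_prop)).measurableSet

theorem volume_cell_ne_top (S : Finset (EuclideanSpace ℝ (Fin d)))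
    (t : EuclideanSpace ℝ (Fin d)) : volume (cell S t) ≠ ∞ :=
  measure_ne_top_of_subset (cell_subset_region S t) (isCompact_region S).measure_ne_top

theorem biUnion_cell (S : Finset (EuclideanSpace ℝ (Fin d))) : ⋃ t ∈ S, cell S t = region S := by
  refine Set.Subset.antisymm (Set.iUnion₂_subset fun t _ => cell_subset_region S t) fun x hx => ?_
  have nonempty : S.Nonempty := Finset.coe_nonempty.1 (convexHull_nonempty_iff.1 ⟨x, hx⟩)
  obtain ⟨t, ht, nearest⟩ := S.exists_min_image (fun s => dist x s) nonempty
  exact Set.mem_biUnion ht ⟨hx, nearest⟩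

theorem volume_cell_inter_cell {S : Finset (EuclideanSpace ℝ (Fin d))}
    {t s : EuclideanSpace ℝ (Fin d)} (ht : t ∈ S) (hs : s ∈ S) (hts : t ≠ s) :
    volume (cell S t ∩ cell S s) = 0 := by
  refine measure_mono_null (fun x hx => ?_)
    (Measure.addHaar_affineSubspace volume (AffineSubspace.perpBisector t s) (by simpa using hts))
  exact AffineSubspace.mem_perpBisector_iff_dist_eq.2 (le_antisymm (hx.1.2 s hs) (hx.2.2 t ht))

theorem volume_restrict_region (S : Finset (EuclideanSpace ℝ (Fin d))) :
    (volume : Measure (EuclideanSpace ℝ (Fin d))).restrict (region S) =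
      ∑ t ∈ S, volume.restrict (cell S t) := by
  ext A hA
  have lintegral_eq := lintegral_biUnion_finset₀ (μ := volume) (s := S) (t := cell S)
    (fun t ht s hs hts => volume_cell_inter_cell ht hs hts)
    (fun t _ => (measurableSet_cell S t).nullMeasurableSet) (A.indicator 1)
  rw [biUnion_cell] at lintegral_eq
  simpa [lintegral_indicator_one hA] using lintegral_eq

theorem sum_volume_cell (S : Finset (EuclideanSpace ℝ (Fin d))) :
    ∑ t ∈ S, volume (cell S t) = volume (region S) := by
  simpa using (congrArg (· Set.univ) (volume_restrict_region S)).symm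

theorem meshSize_nonneg (S : Finset (EuclideanSpace ℝ (Fin d))) : 0 ≤ meshSize S := by
  refine Real.sSup_nonneg ?_
  rintro r ⟨t, -, x, -, rfl⟩
  exact dist_nonneg

theorem dist_le_meshSize {S : Finset (EuclideanSpace ℝ (Fin d))}
    {t x : EuclideanSpace ℝ (Fin d)} (ht : t ∈ S) (hx : x ∈ cell S t) :
    dist x t ≤ meshSize S := by
  refine le_csSup ⟨Metric.diam (region S), ?_⟩ ⟨t, ht, x, hx, rfl⟩
  rintro r ⟨s, hs, y, hy, rfl⟩
  exact Metric.dist_le_diam_of_mem (isCompact_region S).isBounded hy.1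
    (subset_convexHull ℝ _ hs)

theorem meshSize_pos [Nontrivial (EuclideanSpace ℝ (Fin d))]
    {S : Finset (EuclideanSpace ℝ (Fin d))} (h : 0 < volume.real (region S)) :
    0 < meshSize S := by
  refine (meshSize_nonneg S).lt_of_ne fun meshSize_eq_zero => h.ne' ?_
  have region_subset : region S ⊆ S := by
    intro x hx
    rw [← biUnion_cell, Set.mem_iUnion₂] at hx
    obtain ⟨t, ht, hx⟩ := hx
    have dist_le := dist_le_meshSize ht hx
    rw [← meshSize_eq_zero] at dist_le
    rwa [dist_le_zero.1 dist_le]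
  rw [measureReal_def, measure_mono_null region_subset (S.finite_toSet.measure_zero _),
    ENNReal.toReal_zero]

theorem SamplingDesign.exists_closedBall_subset {S : ℕ → Finset (EuclideanSpace ℝ (Fin d))}
    (hS : SamplingDesign S) : ∃ r : ℝ, 0 < r ∧ ∀ᶠ n in atTop, ∃ z,
      Metric.closedBall z (r * volume.real (region (S n)) ^ (1 / d : ℝ)) ⊆ region (S n) := by
  obtain ⟨T, T_bounded, -, ⟨z, hz⟩, shape_tendsto⟩ := hS.shape
  obtain ⟨ρ, hρ, ball_subset⟩ := Metric.isOpen_iff.1 isOpen_interior z hz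
  have hr : 0 < ρ / 4 := by positivity
  refine ⟨ρ / 4, hr, ?_⟩
  filter_upwards [shape_tendsto.eventually_lt_const hr, hS.volume_tendsto.eventually_gt_atTop 0]
    with n dist_lt volume_pos
  set L := volume.real (region (S n)) ^ (1 / d : ℝ)
  have hL : 0 < L := Real.rpow_pos_of_pos volume_pos _
  have nonempty : (region (S n)).Nonempty :=
    nonempty_of_measure_ne_zero (ENNReal.toReal_pos_iff.1 volume_pos).1.ne'
  have compact_scaled := (isCompact_region (S n)).smul L⁻¹
  have scaled_ball_subset := closedBall_subset_of_hausdorffDist_lt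
    ((convex_region (S n)).smul L⁻¹) compact_scaled.isClosed compact_scaled.isBounded
    nonempty.smul_set T_bounded hr (fun x hx => interior_subset
      (ball_subset (Metric.closedBall_subset_ball (by linarith) hx))) dist_lt
  refine ⟨L • z, ?_⟩
  have := Set.smul_set_mono (a := L) scaled_ball_subset
  rwa [smul_inv_smul₀ hL.ne', smul_closedBall _ _ hr.le, Real.norm_of_nonneg hL.le,
    mul_comm] at this

theorem SamplingDesign.dim_pos {S : ℕ → Finset (EuclideanSpace ℝ (Fin d))}
    (hS : SamplingDesign S) : 0 < d := by
  rcases Nat.eq_zero_or_pos d with rfl | h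
  · obtain ⟨n, hn⟩ := (hS.volume_tendsto.eventually_gt_atTop
      (volume.real (Set.univ : Set (EuclideanSpace ℝ (Fin 0))))).exists
    exact absurd (measureReal_mono (Set.subset_univ _) (measure_ne_top _ _))
      hn.not_ge
  · exact h

end Sampling

section OverlapIntegral

variable {E : Type*} [AddCommGroup E] [MeasurableSpace E] {T : Set E} {μ : Measure E}
  {F : Type*} [NormedAddCommGroup F] {G : E → F}

theorem integrable_indicator_add_mem [MeasurableAdd₂ E] [SFinite μ] (hT : MeasurableSet T)
    (finite_volume : μ T ≠ ∞) (hG : Integrable G μ) :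
    Integrable (fun p : E × E => {h | p.1 + h ∈ T}.indicator G p.2) ((μ.restrict T).prod μ) := by
  have : IsFiniteMeasure (μ.restrict T) := isFiniteMeasure_restrict.2 finite_volume
  exact (hG.comp_snd (μ.restrict T)).indicator (s := {p : E × E | p.1 + p.2 ∈ T})
    ((measurable_fst.add measurable_snd) hT)

variable [NormedSpace ℝ F]

theorem setIntegral_sub_eq_integral_indicator [MeasurableAdd E] [μ.IsAddLeftInvariant]
    (hT : MeasurableSet T) (G : E → F) (y : E) :
    ∫ x in T, G (x - y) ∂μ = ∫ h, {h | y + h ∈ T}.indicator G h ∂μ := by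
  rw [← integral_indicator hT, ← integral_add_left_eq_self (T.indicator fun x => G (x - y)) y]
  refine integral_congr_ae (ae_of_all _ fun h => ?_)
  by_cases hy : y + h ∈ T <;> simp [hy]

variable [MeasurableAdd₂ E] [SFinite μ] [μ.IsAddLeftInvariant]

theorem integrableOn_setIntegral_sub (hT : MeasurableSet T) (finite_volume : μ T ≠ ∞)
    (hG : Integrable G μ) : IntegrableOn (fun y => ∫ x in T, G (x - y) ∂μ) T μ := by
  simp_rw [setIntegral_sub_eq_integral_indicator hT]
  exact (integrable_indicator_add_mem hT finite_volume hG).integral_prod_left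

theorem setIntegral_setIntegral_sub [CompleteSpace F] (hT : MeasurableSet T)
    (finite_volume : μ T ≠ ∞) (hG : Integrable G μ) :
    ∫ y in T, ∫ x in T, G (x - y) ∂μ ∂μ = ∫ h, overlap μ T h • G h ∂μ := by
  simp_rw [setIntegral_sub_eq_integral_indicator hT]
  rw [integral_integral_swap (integrable_indicator_add_mem hT finite_volume hG)]
  refine integral_congr_ae (ae_of_all _ fun h => ?_)
  have translate_measurable : MeasurableSet {y | y + h ∈ T} := (measurable_add_const h) hT
  change ∫ y in T, {y | y + h ∈ T}.indicator (fun _ => G h) y ∂μ = overlap μ T h • G h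
  rw [integral_indicator translate_measurable, Measure.restrict_restrict translate_measurable,
    setIntegral_const, overlap, Set.inter_comm]
  congr 3
  ext y
  exact mem_neg_vadd_iff.symm

end OverlapIntegral

section Covariance

variable {d : ℕ} {H : Type*} [NormedAddCommGroup H] [InnerProductSpace ℂ H] [CompleteSpace H]
  {ι : Type*} (b : HilbertBasis ι ℂ H) (C : EuclideanSpace ℝ (Fin d) → H →L[ℂ] H)

theorem traceNorm_sub_le_oscillation {δ : ℝ} {x y : EuclideanSpace ℝ (Fin d)}
    (h : dist y x ≤ δ) : traceNorm b (C y - C x) ≤ oscillation b C δ x :=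
  le_iSup₂ (f := fun y (_ : y ∈ Metric.closedBall x δ) => traceNorm b (C y - C x)) y h

section Regularity

variable {b C} {γ : ℝ}

theorem CovarianceRegular.ae_forall_exists_oscillation_lt (hC : CovarianceRegular b C γ) :
    ∀ᵐ x, ∀ ε : ℝ≥0∞, 0 < ε → ∃ δ : ℝ, 0 < δ ∧ oscillation b C δ x < ε := by
  obtain ⟨hγ, -, M, δ₀, hδ₀, hM⟩ := hC.holder
  set δ : ℕ → ℝ := fun k => δ₀ / (k + 1)
  have δ_pos (k) : 0 < δ k := by positivity
  have δ_le (k) : δ k ≤ δ₀ := div_le_self hδ₀.le (by linarith [(Nat.cast_nonneg k : (0 : ℝ) ≤ k)])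
  have δ_tendsto : Tendsto δ atTop (𝓝 0) := by
    simpa [δ, div_eq_mul_inv] using tendsto_one_div_add_atTop_nhds_zero_nat.const_mul δ₀
  have bound_tendsto : Tendsto (fun k => ENNReal.ofReal (M * δ k ^ γ)) atTop (𝓝 0) := by
    simpa [Real.zero_rpow hγ.ne'] using
      ENNReal.tendsto_ofReal ((δ_tendsto.rpow_const (Or.inr hγ.le)).const_mul M)
  have lintegral_iInf_eq_zero : ∫⁻ x, ⨅ k, oscillation b C (δ k) x = 0 := by
    refine le_antisymm (ge_of_tendsto' bound_tendsto fun k => ?_) bot_le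
    exact (lintegral_mono fun x => iInf_le _ k).trans (hM (δ k) (δ_pos k) (δ_le k)).2
  rw [lintegral_eq_zero_iff' (AEMeasurable.iInf fun k => (hM (δ k) (δ_pos k) (δ_le k)).1)]
    at lintegral_iInf_eq_zero
  filter_upwards [lintegral_iInf_eq_zero] with x hx ε hε
  obtain ⟨k, hk⟩ := iInf_lt_iff.1 (hx.trans_lt hε)
  exact ⟨δ k, δ_pos k, hk⟩

theorem CovarianceRegular.ae_continuousAt (hC : CovarianceRegular b C γ) :
    ∀ᵐ x, ContinuousAt C x := by
  filter_upwards [hC.ae_forall_exists_oscillation_lt] with x hx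
  rw [EMetric.continuousAt_iff]
  intro ε hε
  obtain ⟨δ, hδ, oscillation_lt⟩ := hx ε hε
  refine ⟨ENNReal.ofReal δ, ENNReal.ofReal_pos.2 hδ, fun y hy => ?_⟩
  rw [edist_dist, ENNReal.ofReal_lt_ofReal_iff hδ] at hy
  rw [edist_eq_enorm_sub]
  exact ((enorm_le_traceNorm b _).trans
    (traceNorm_sub_le_oscillation b C hy.le)).trans_lt oscillation_lt

theorem CovarianceRegular.aestronglyMeasurable (hC : CovarianceRegular b C γ) :
    AEStronglyMeasurable C volume := by
  have continuousOn_C : ContinuousOn C {x | ContinuousAt C x} :=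
    fun x hx => ContinuousAt.continuousWithinAt hx
  have := continuousOn_C.aestronglyMeasurable (μ := volume) (measurableSet_of_continuousAt C)
  rwa [Measure.restrict_eq_self_of_ae_mem (s := {x | ContinuousAt C x}) hC.ae_continuousAt] at this

theorem CovarianceRegular.integrable_covariance (hC : CovarianceRegular b C γ) :
    Integrable C volume :=
  ⟨hC.aestronglyMeasurable,
    (lintegral_mono fun h => enorm_le_traceNorm b (C h)).trans_lt hC.integrable⟩

end Regularity

/-- The integral bound, uniform in `t`, for the covariances `C (t - s)` summed over the locations
`s` with the volumes of their cells. -/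
noncomputable def covarianceMass (δ : ℝ) : ℝ≥0∞ :=
  ∫⁻ x, 2 * (traceNorm b (C x) + oscillation b C δ x)

theorem crossNorm_le_of_dist_le {δ : ℝ} {x y : EuclideanSpace ℝ (Fin d)} (h : dist y x ≤ δ) :
    crossNorm b (C y) ≤ 2 * (traceNorm b (C x) + oscillation b C δ x) := by
  calc crossNorm b (C y) = crossNorm b (C x + (C y - C x)) := by rw [add_sub_cancel]
    _ ≤ 2 * traceNorm b (C x) + 2 * traceNorm b (C y - C x) :=
        (crossNorm_add_le b _ _).trans (add_le_add (crossNorm_le_two_mul_traceNorm b _)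
          (crossNorm_le_two_mul_traceNorm b _))
    _ ≤ 2 * (traceNorm b (C x) + oscillation b C δ x) := by
        rw [← mul_add]
        gcongr
        exact traceNorm_sub_le_oscillation b C h

end Covariance

section RiemannSum

variable {d : ℕ} (S : Finset (EuclideanSpace ℝ (Fin d)))

theorem sum_volume_cell_mul_le (c F : EuclideanSpace ℝ (Fin d) → ℝ≥0∞)
    (h : ∀ s ∈ S, ∀ y ∈ cell S s, c s ≤ F y) :
    ∑ s ∈ S, volume (cell S s) * c s ≤ ∫⁻ y in region S, F y := by
  rw [volume_restrict_region, lintegral_finsetSum_measure]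
  refine Finset.sum_le_sum fun s hs => ?_
  rw [mul_comm, ← setLIntegral_const]
  exact setLIntegral_mono' (measurableSet_cell S s) (h s hs)

theorem sum_volume_cell_mul_crossNorm_le {H : Type*} [NormedAddCommGroup H]
    [InnerProductSpace ℂ H] [CompleteSpace H] {ι : Type*} (b : HilbertBasis ι ℂ H)
    (C : EuclideanSpace ℝ (Fin d) → H →L[ℂ] H) (t : EuclideanSpace ℝ (Fin d)) :
    ∑ s ∈ S, volume (cell S s) * crossNorm b (C (t - s)) ≤ covarianceMass b C (meshSize S) := by
  set F := fun x => 2 * (traceNorm b (C x) + oscillation b C (meshSize S) x)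
  calc ∑ s ∈ S, volume (cell S s) * crossNorm b (C (t - s))
      ≤ ∫⁻ y in region S, F (t - y) := by
        refine sum_volume_cell_mul_le S _ _ fun s hs y hy => crossNorm_le_of_dist_le b C ?_
        rw [dist_sub_left, dist_comm]
        exact dist_le_meshSize hs hy
    _ ≤ ∫⁻ y, F (t - y) := setLIntegral_le_lintegral _ _
    _ = covarianceMass b C (meshSize S) := lintegral_sub_left_eq_self F t

theorem sum_cell_smul_sub_integral_overlap {F : Type*} [NormedAddCommGroup F] [NormedSpace ℝ F]
    [CompleteSpace F] {G : EuclideanSpace ℝ (Fin d) → F} (hG : Integrable G) :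
    ∑ t ∈ S, ∑ s ∈ S, (volume.real (cell S t) * volume.real (cell S s)) • G (t - s) -
        ∫ h, overlap volume (region S) h • G h =
      ∑ s ∈ S, ∫ y in cell S s, ∑ t ∈ S, ∫ x in cell S t, (G (t - s) - G (x - y)) := by
  have finite_cell (t) :
      IsFiniteMeasure ((volume : Measure (EuclideanSpace ℝ (Fin d))).restrict (cell S t)) :=
    isFiniteMeasure_restrict.2 (volume_cell_ne_top S t)
  have integrable_cell (t y) : IntegrableOn (fun x => G (x - y)) (cell S t) :=
    (hG.comp_sub_right y).integrableOn
  have integrable_region := integrableOn_setIntegral_sub (measurableSet_region S)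
    (isCompact_region S).measure_ne_top hG
  have integrable_cell_region (s) :
      IntegrableOn (fun y => ∫ x in region S, G (x - y)) (cell S s) :=
    integrable_region.mono_set (cell_subset_region S s)
  have inner_integral (s y) : ∑ t ∈ S, ∫ x in cell S t, (G (t - s) - G (x - y)) =
      ∑ t ∈ S, volume.real (cell S t) • G (t - s) - ∫ x in region S, G (x - y) := by
    rw [volume_restrict_region, integral_finsetSum_measure fun t _ => integrable_cell t y,
      ← Finset.sum_sub_distrib]
    refine Finset.sum_congr rfl fun t _ => ?_
    rw [integral_sub (integrable_const _) (integrable_cell t y), setIntegral_const]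
  have outer_integral : ∫ h, overlap volume (region S) h • G h =
      ∑ s ∈ S, ∫ y in cell S s, ∫ x in region S, G (x - y) := by
    rw [← setIntegral_setIntegral_sub (measurableSet_region S)
      (isCompact_region S).measure_ne_top hG, ← integral_finsetSum_measure fun s _ =>
      integrable_cell_region s, ← volume_restrict_region]
  rw [outer_integral, Finset.sum_comm, ← Finset.sum_sub_distrib]
  refine Finset.sum_congr rfl fun s _ => ?_
  simp_rw [inner_integral]
  rw [integral_sub (integrable_const _) (integrable_cell_region s), setIntegral_const,
    Finset.smul_sum]
  simp_rw [smul_smul, mul_comm]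

theorem hsNorm_sum_cell_smul_sub_integral_overlap_le {H : Type*} [NormedAddCommGroup H]
    [InnerProductSpace ℂ H] [CompleteSpace H] {ι : Type*} (b : HilbertBasis ι ℂ H)
    {G : EuclideanSpace ℝ (Fin d) → H →L[ℂ] H} (hG : Integrable G)
    (F : EuclideanSpace ℝ (Fin d) → ℝ≥0∞)
    (hF : ∀ h h', dist h' h ≤ 2 * meshSize S → hsNorm b (G h' - G h) ≤ F h) :
    hsNorm b (∑ t ∈ S, ∑ s ∈ S, (volume.real (cell S t) * volume.real (cell S s)) • G (t - s) -
      ∫ h, overlap volume (region S) h • G h) ≤ volume (region S) * ∫⁻ h, F h := by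
  rw [sum_cell_smul_sub_integral_overlap S hG]
  calc hsNorm b (∑ s ∈ S, ∫ y in cell S s, ∑ t ∈ S, ∫ x in cell S t, (G (t - s) - G (x - y)))
      ≤ ∑ s ∈ S, ∫⁻ y in cell S s, ∑ t ∈ S,
          ∫⁻ x in cell S t, hsNorm b (G (t - s) - G (x - y)) := by
        refine (hsNorm_sum_le b _ _).trans (Finset.sum_le_sum fun s _ => ?_)
        refine (hsNorm_integral_le b _ _).trans (lintegral_mono fun y => ?_)
        refine (hsNorm_sum_le b _ _).trans (Finset.sum_le_sum fun t _ => ?_)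
        exact hsNorm_integral_le b _ _
    _ ≤ ∑ s ∈ S, ∫⁻ y in cell S s, ∑ t ∈ S, ∫⁻ x in cell S t, F (x - y) := by
        refine Finset.sum_le_sum fun s hs => setLIntegral_mono' (measurableSet_cell S s) fun y hy =>
          Finset.sum_le_sum fun t ht => setLIntegral_mono' (measurableSet_cell S t) fun x hx => ?_
        refine hF _ _ ?_
        calc dist (t - s) (x - y) ≤ dist t x + dist s y := dist_sub_sub_le _ _ _ _
          _ ≤ meshSize S + meshSize S := by
              rw [dist_comm t, dist_comm s]
              exact add_le_add (dist_le_meshSize ht hx) (dist_le_meshSize hs hy)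
          _ = 2 * meshSize S := (two_mul _).symm
    _ ≤ ∑ s ∈ S, ∫⁻ _y in cell S s, ∫⁻ h, F h := by
        refine Finset.sum_le_sum fun s _ => lintegral_mono fun y => ?_
        rw [← lintegral_finsetSum_measure, ← volume_restrict_region]
        exact (setLIntegral_le_lintegral _ _).trans_eq (lintegral_sub_right_eq_self F y)
    _ = volume (region S) * ∫⁻ h, F h := by
        simp_rw [setLIntegral_const]
        rw [← Finset.mul_sum, sum_volume_cell, mul_comm]

end RiemannSum

section Window

variable {d : ℕ}

theorem norm_character (θ h : EuclideanSpace ℝ (Fin d)) : ‖character θ h‖ = 1 := by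
  rw [character, mul_comm, Complex.norm_exp_ofReal_mul_I]

theorem continuous_character (θ : EuclideanSpace ℝ (Fin d)) : Continuous (character θ) := by
  unfold character
  fun_prop

theorem integrable_character_smul {F : Type*} [NormedAddCommGroup F] [NormedSpace ℂ F]
    {C : EuclideanSpace ℝ (Fin d) → F} (hC : Integrable C) (θ : EuclideanSpace ℝ (Fin d)) :
    Integrable fun h => character θ h • C h :=
  hC.bdd_smul 1 (continuous_character θ).aestronglyMeasurable
    (ae_of_all _ fun h => (norm_character θ h).le)

theorem norm_character_sub_le (θ h h' : EuclideanSpace ℝ (Fin d)) :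
    ‖character θ h' - character θ h‖ ≤ ‖h' - h‖ * ‖θ‖ := by
  have factor : character θ h' - character θ h =
      character θ h * (character θ (h' - h) - 1) := by
    rw [character, character, character, mul_sub, ← Complex.exp_add, mul_one, inner_sub_left]
    congr 2
    push_cast
    ring
  rw [factor, norm_mul, norm_character, one_mul]
  exact Real.norm_exp_I_mul_ofReal_sub_one_le.trans (norm_inner_le_norm _ _)

/-- The weight `exp(i hᵀθ) K(h/Δ) / |T ∩ (T - h)|` of the lag `h`. -/
noncomputable def lagWeight (T : Set (EuclideanSpace ℝ (Fin d)))
    (K : EuclideanSpace ℝ (Fin d) → ℝ) (Δ : ℝ) (θ h : EuclideanSpace ℝ (Fin d)) : ℂ :=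
  character θ h * ((K (Δ⁻¹ • h) / overlap volume T h : ℝ) : ℂ)

/-- A convex region `T` that contains a ball of radius `R ≥ 4 ρ Δ`, so that it is wide compared with
the ball of radius `ρ Δ` of lags at which the kernel `h ↦ K(h/Δ)` can be nonzero. -/
structure AdmissibleWindow (T : Set (EuclideanSpace ℝ (Fin d)))
    (K : EuclideanSpace ℝ (Fin d) → ℝ) (L : ℝ≥0) (ρ Δ R : ℝ) : Prop where
  convex : Convex ℝ T
  compact : IsCompact T
  ball : ∃ z, Metric.closedBall z R ⊆ T
  volume_pos : 0 < volume.real T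
  one_le_radius : 1 ≤ R
  one_le_bandwidth : 1 ≤ Δ
  fit : ρ * Δ ≤ R / 4
  support : ∀ u, K u ≠ 0 → ‖u‖ ≤ ρ
  lipschitz : LipschitzWith L K
  nonneg : ∀ u, 0 ≤ K u
  le_one : ∀ u, K u ≤ 1

namespace AdmissibleWindow

variable {T : Set (EuclideanSpace ℝ (Fin d))} {K : EuclideanSpace ℝ (Fin d) → ℝ}
  {L : ℝ≥0} {ρ Δ R : ℝ} {h h' : EuclideanSpace ℝ (Fin d)}

theorem bandwidth_pos (hw : AdmissibleWindow T K L ρ Δ R) : 0 < Δ :=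
  one_pos.trans_le hw.one_le_bandwidth

theorem norm_le (hw : AdmissibleWindow T K L ρ Δ R) (hh : K (Δ⁻¹ • h) ≠ 0) : ‖h‖ ≤ ρ * Δ := by
  have norm_scaled_le := hw.support _ hh
  rwa [norm_smul, norm_inv, Real.norm_of_nonneg hw.bandwidth_pos.le,
    inv_mul_le_iff₀ hw.bandwidth_pos, mul_comm] at norm_scaled_le

theorem norm_le_half_of_dist_le (hw : AdmissibleWindow T K L ρ Δ R) (hh : K (Δ⁻¹ • h) ≠ 0)
    (hd : ‖h' - h‖ ≤ R / 4) : ‖h'‖ ≤ R / 2 := by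
  have := norm_add_le h (h' - h)
  rw [add_sub_cancel] at this
  linarith [hw.norm_le hh, hw.fit]

theorem norm_le_half (hw : AdmissibleWindow T K L ρ Δ R) (hh : K (Δ⁻¹ • h) ≠ 0) : ‖h‖ ≤ R / 2 := by
  linarith [hw.norm_le hh, hw.fit, hw.one_le_radius]

theorem mul_volume_le_overlap (hw : AdmissibleWindow T K L ρ Δ R) (hh : ‖h‖ ≤ R / 2) :
    (1 / 2) ^ d * volume.real T ≤ overlap volume T h := by
  obtain ⟨z, hz⟩ := hw.ball
  have := one_sub_pow_mul_le_overlap volume (k := h) (ε := 1 / 2) hw.convex hw.compact hz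
    (by norm_num) (by norm_num) (by linarith)
  rw [finrank_euclideanSpace_fin] at this
  norm_num at this ⊢
  exact this

theorem overlap_pos (hw : AdmissibleWindow T K L ρ Δ R) (hh : ‖h‖ ≤ R / 2) :
    0 < overlap volume T h :=
  (mul_pos (by positivity) hw.volume_pos).trans_le (hw.mul_volume_le_overlap hh)

theorem inv_overlap_le (hw : AdmissibleWindow T K L ρ Δ R) (hh : ‖h‖ ≤ R / 2) :
    (overlap volume T h)⁻¹ ≤ 2 ^ d / volume.real T := by
  calc (overlap volume T h)⁻¹ ≤ ((1 / 2 : ℝ) ^ d * volume.real T)⁻¹ :=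
        inv_anti₀ (mul_pos (by positivity) hw.volume_pos) (hw.mul_volume_le_overlap hh)
    _ = 2 ^ d / volume.real T := by rw [mul_inv, ← inv_pow, one_div, inv_inv, div_eq_mul_inv]

theorem abs_overlap_sub_le (hw : AdmissibleWindow T K L ρ Δ R) (hd : ‖h' - h‖ ≤ R) :
    |overlap volume T h' - overlap volume T h| ≤ d * ‖h' - h‖ * volume.real T := by
  obtain ⟨z, hz⟩ := hw.ball
  have := abs_overlap_sub_overlap_le volume hw.convex hw.compact hz
    (one_pos.trans_le hw.one_le_radius) hd
  rw [finrank_euclideanSpace_fin] at this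
  refine this.trans ?_
  gcongr
  exact div_le_self (norm_nonneg _) hw.one_le_radius

theorem continuous_overlap (hw : AdmissibleWindow T K L ρ Δ R) : Continuous (overlap volume T) := by
  rw [continuous_iff_continuousAt]
  intro h
  rw [ContinuousAt, tendsto_iff_norm_sub_tendsto_zero]
  have bound_tendsto : Tendsto (fun k => d * ‖k - h‖ * volume.real T) (𝓝 h) (𝓝 0) := by
    have : Continuous fun k : EuclideanSpace ℝ (Fin d) => d * ‖k - h‖ * volume.real T := by fun_prop
    simpa using this.tendsto h
  refine squeeze_zero' (Eventually.of_forall fun k => norm_nonneg _) ?_ bound_tendsto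
  filter_upwards [Metric.closedBall_mem_nhds h (one_pos.trans_le hw.one_le_radius)] with k hk
  exact hw.abs_overlap_sub_le (mem_closedBall_iff_norm.1 hk)

theorem abs_kernel_sub_le (hw : AdmissibleWindow T K L ρ Δ R) (h h' : EuclideanSpace ℝ (Fin d)) :
    |K (Δ⁻¹ • h') - K (Δ⁻¹ • h)| ≤ L * ‖h' - h‖ := by
  have dist_le := hw.lipschitz.dist_le_mul (Δ⁻¹ • h') (Δ⁻¹ • h)
  rw [Real.dist_eq, dist_eq_norm, ← smul_sub, norm_smul, norm_inv,
    Real.norm_of_nonneg hw.bandwidth_pos.le] at dist_le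
  refine dist_le.trans ?_
  gcongr
  exact mul_le_of_le_one_left (norm_nonneg _) (inv_le_one_of_one_le₀ hw.one_le_bandwidth)

theorem kernel_div_overlap_nonneg (hw : AdmissibleWindow T K L ρ Δ R)
    (h : EuclideanSpace ℝ (Fin d)) : 0 ≤ K (Δ⁻¹ • h) / overlap volume T h :=
  div_nonneg (hw.nonneg _) (overlap_nonneg _ _ _)

theorem kernel_div_overlap_le (hw : AdmissibleWindow T K L ρ Δ R)
    (h : EuclideanSpace ℝ (Fin d)) :
    K (Δ⁻¹ • h) / overlap volume T h ≤ 2 ^ d / volume.real T := by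
  by_cases hh : K (Δ⁻¹ • h) = 0
  · rw [hh, zero_div]
    positivity
  · rw [div_eq_mul_inv]
    exact (mul_le_of_le_one_left (inv_nonneg.2 (overlap_nonneg _ _ _)) (hw.le_one _)).trans
      (hw.inv_overlap_le (hw.norm_le_half hh))

theorem abs_kernel_div_overlap_sub_le (hw : AdmissibleWindow T K L ρ Δ R)
    (hh : ‖h‖ ≤ R / 2) (hh' : ‖h'‖ ≤ R / 2) (hd : ‖h' - h‖ ≤ R) :
    |K (Δ⁻¹ • h') / overlap volume T h' - K (Δ⁻¹ • h) / overlap volume T h| ≤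
      ‖h' - h‖ * (2 ^ d * L + 4 ^ d * d) / volume.real T := by
  have hV := hw.volume_pos
  have hg := hw.overlap_pos hh
  have hg' := hw.overlap_pos hh'
  have inv_le := hw.inv_overlap_le hh
  have inv_le' := hw.inv_overlap_le hh'
  have overlap_sub_le := hw.abs_overlap_sub_le hd
  have kernel_sub_le := hw.abs_kernel_sub_le h h'
  have kernel_nonneg := hw.nonneg (Δ⁻¹ • h)
  have kernel_le_one := hw.le_one (Δ⁻¹ • h)
  set g := overlap volume T h
  set g' := overlap volume T h'
  set V := volume.real T
  calc |K (Δ⁻¹ • h') / g' - K (Δ⁻¹ • h) / g|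
      = |(K (Δ⁻¹ • h') - K (Δ⁻¹ • h)) * g'⁻¹ +
          K (Δ⁻¹ • h) * ((g - g') * (g⁻¹ * g'⁻¹))| := by
        congr 1
        field_simp
        ring
    _ ≤ |K (Δ⁻¹ • h') - K (Δ⁻¹ • h)| * g'⁻¹ + K (Δ⁻¹ • h) * (|g' - g| * (g⁻¹ * g'⁻¹)) := by
        refine (abs_add_le _ _).trans_eq ?_
        rw [abs_mul, abs_mul, abs_mul, abs_of_pos (inv_pos.2 hg'), abs_of_nonneg kernel_nonneg,
          abs_of_pos (mul_pos (inv_pos.2 hg) (inv_pos.2 hg')), abs_sub_comm g]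
    _ ≤ L * ‖h' - h‖ * (2 ^ d / V) +
          1 * (d * ‖h' - h‖ * V * ((2 ^ d / V) * (2 ^ d / V))) := by gcongr
    _ = ‖h' - h‖ * (2 ^ d * L + 4 ^ d * d) / V := by
        rw [show (4 : ℝ) ^ d = 2 ^ d * 2 ^ d by rw [← mul_pow]; norm_num]
        field_simp

theorem norm_lagWeight (hw : AdmissibleWindow T K L ρ Δ R) (θ h : EuclideanSpace ℝ (Fin d)) :
    ‖lagWeight T K Δ θ h‖ = K (Δ⁻¹ • h) / overlap volume T h := by
  rw [lagWeight, norm_mul, norm_character, one_mul, Complex.norm_real,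
    Real.norm_of_nonneg (hw.kernel_div_overlap_nonneg h)]

theorem norm_lagWeight_le (hw : AdmissibleWindow T K L ρ Δ R) (θ h : EuclideanSpace ℝ (Fin d)) :
    ‖lagWeight T K Δ θ h‖ ≤ 2 ^ d / volume.real T :=
  (hw.norm_lagWeight θ h).trans_le (hw.kernel_div_overlap_le h)

theorem lagWeight_eq_zero (hw : AdmissibleWindow T K L ρ Δ R) {θ : EuclideanSpace ℝ (Fin d)}
    (hh : ρ * Δ < ‖h‖) : lagWeight T K Δ θ h = 0 := by
  have kernel_eq_zero : K (Δ⁻¹ • h) = 0 := not_ne_iff.1 fun hK => hh.not_ge (hw.norm_le hK)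
  simp [lagWeight, kernel_eq_zero]

theorem norm_lagWeight_sub_le (hw : AdmissibleWindow T K L ρ Δ R) {θ : EuclideanSpace ℝ (Fin d)}
    (hd : ‖h' - h‖ ≤ R / 4) :
    ‖lagWeight T K Δ θ h' - lagWeight T K Δ θ h‖ ≤
      ‖h' - h‖ * (2 ^ d * ‖θ‖ + 2 ^ d * L + 4 ^ d * d) / volume.real T := by
  by_cases both_zero : K (Δ⁻¹ • h) = 0 ∧ K (Δ⁻¹ • h') = 0
  · simp only [lagWeight, both_zero.1, both_zero.2, zero_div, Complex.ofReal_zero, mul_zero,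
      sub_zero, norm_zero]
    positivity
  obtain ⟨hh, hh'⟩ : ‖h‖ ≤ R / 2 ∧ ‖h'‖ ≤ R / 2 := by
    rcases not_and_or.1 both_zero with hK | hK
    · exact ⟨hw.norm_le_half hK, hw.norm_le_half_of_dist_le hK hd⟩
    · exact ⟨hw.norm_le_half_of_dist_le hK (by rwa [norm_sub_rev]), hw.norm_le_half hK⟩
  have ratio_sub_le := hw.abs_kernel_div_overlap_sub_le hh hh' (by linarith [hw.one_le_radius])
  set q := K (Δ⁻¹ • h) / overlap volume T h with hq
  set q' := K (Δ⁻¹ • h') / overlap volume T h' with hq'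
  calc ‖lagWeight T K Δ θ h' - lagWeight T K Δ θ h‖
      = ‖(character θ h' - character θ h) * (q : ℂ) + character θ h' * ((q' - q : ℝ) : ℂ)‖ := by
        rw [lagWeight, lagWeight, ← hq, ← hq']
        congr 1
        push_cast
        ring
    _ ≤ ‖character θ h' - character θ h‖ * q + |q' - q| := by
        refine (norm_add_le _ _).trans_eq ?_
        rw [norm_mul, norm_mul, norm_character, one_mul, Complex.norm_real, Complex.norm_real,
          Real.norm_of_nonneg (hw.kernel_div_overlap_nonneg h), Real.norm_eq_abs]
    _ ≤ ‖h' - h‖ * ‖θ‖ * (2 ^ d / volume.real T) +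
          ‖h' - h‖ * (2 ^ d * L + 4 ^ d * d) / volume.real T := by
        gcongr
        · exact hw.kernel_div_overlap_nonneg h
        · exact norm_character_sub_le θ h h'
        · exact hw.kernel_div_overlap_le h
    _ = ‖h' - h‖ * (2 ^ d * ‖θ‖ + 2 ^ d * L + 4 ^ d * d) / volume.real T := by ring

theorem measurable_lagWeight (hw : AdmissibleWindow T K L ρ Δ R) (θ : EuclideanSpace ℝ (Fin d)) :
    Measurable (lagWeight T K Δ θ) := by
  have measurable_kernel : Measurable fun h : EuclideanSpace ℝ (Fin d) => K (Δ⁻¹ • h) :=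
    (hw.lipschitz.continuous.comp (continuous_const_smul _)).measurable
  exact (continuous_character θ).measurable.mul
    (Complex.measurable_ofReal.comp (measurable_kernel.div hw.continuous_overlap.measurable))

end AdmissibleWindow

end Window

theorem enorm_le_ofReal {F : Type*} [SeminormedAddCommGroup F] {x : F} {c : ℝ} (h : ‖x‖ ≤ c) :
    ‖x‖ₑ ≤ ENNReal.ofReal c := by
  rw [← ofReal_norm]
  exact ENNReal.ofReal_le_ofReal h

section Discretization

variable {d : ℕ} {K : EuclideanSpace ℝ (Fin d) → ℝ} {L : ℝ≥0} {ρ Δ R : ℝ}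

/-- The expectation of the lag-window estimator, up to the factor `(2π)⁻ᵈ`. -/
noncomputable def meanSum {F : Type*} [AddCommGroup F] [Module ℂ F]
    (C : EuclideanSpace ℝ (Fin d) → F) (S : Finset (EuclideanSpace ℝ (Fin d)))
    (K : EuclideanSpace ℝ (Fin d) → ℝ) (Δ : ℝ) (θ : EuclideanSpace ℝ (Fin d)) : F :=
  ∑ t ∈ S, ∑ s ∈ S, (volume.real (cell S t) * volume.real (cell S s)) •
    lagWeight (region S) K Δ θ (t - s) • C (t - s)

namespace AdmissibleWindow

theorem integral_overlap_smul_lagWeight_smul {F : Type*} [NormedAddCommGroup F] [NormedSpace ℂ F]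
    {T : Set (EuclideanSpace ℝ (Fin d))} (hw : AdmissibleWindow T K L ρ Δ R)
    (C : EuclideanSpace ℝ (Fin d) → F) (θ : EuclideanSpace ℝ (Fin d)) :
    ∫ h, overlap volume T h • lagWeight T K Δ θ h • C h =
      ∫ h, (character θ h * (K (Δ⁻¹ • h) : ℂ)) • C h := by
  refine integral_congr_ae (ae_of_all _ fun h => ?_)
  change overlap volume T h • lagWeight T K Δ θ h • C h = _
  by_cases hh : K (Δ⁻¹ • h) = 0
  · simp [lagWeight, hh]
  · have overlap_ne_zero : (overlap volume T h : ℂ) ≠ 0 := by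
      exact_mod_cast (hw.overlap_pos (hw.norm_le_half hh)).ne'
    rw [← Complex.coe_smul, smul_smul, lagWeight]
    congr 1
    push_cast
    field_simp

variable {H : Type*} [NormedAddCommGroup H] [InnerProductSpace ℂ H] [CompleteSpace H]
  {ι : Type*} {b : HilbertBasis ι ℂ H} {C : EuclideanSpace ℝ (Fin d) → H →L[ℂ] H} {γ : ℝ}

theorem hsNorm_lagWeight_smul_sub_le {T : Set (EuclideanSpace ℝ (Fin d))}
    (hw : AdmissibleWindow T K L ρ Δ R) (b : HilbertBasis ι ℂ H)
    (C : EuclideanSpace ℝ (Fin d) → H →L[ℂ] H) {δ : ℝ} (hδ : δ ≤ R / 4)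
    {θ h h' : EuclideanSpace ℝ (Fin d)} (hh : dist h' h ≤ δ) :
    hsNorm b (lagWeight T K Δ θ h' • C h' - lagWeight T K Δ θ h • C h) ≤
      ENNReal.ofReal (δ * (2 ^ d * ‖θ‖ + 2 ^ d * L + 4 ^ d * d) / volume.real T) *
          traceNorm b (C h) +
        ENNReal.ofReal (2 ^ d / volume.real T) * oscillation b C δ h := by
  have norm_sub_le : ‖h' - h‖ ≤ δ := by rwa [← dist_eq_norm]
  have split : lagWeight T K Δ θ h' • C h' - lagWeight T K Δ θ h • C h =
      (lagWeight T K Δ θ h' - lagWeight T K Δ θ h) • C h +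
        lagWeight T K Δ θ h' • (C h' - C h) := by
    rw [sub_smul, smul_sub]
    abel
  rw [split]
  refine (hsNorm_add_le b _ _).trans
    (add_le_add ((hsNorm_smul_le b _ _).trans ?_) ((hsNorm_smul_le b _ _).trans ?_))
  · gcongr
    · refine enorm_le_ofReal ((hw.norm_lagWeight_sub_le (norm_sub_le.trans hδ)).trans ?_)
      gcongr
    · exact hsNorm_le_traceNorm b _
  · gcongr
    · exact enorm_le_ofReal (hw.norm_lagWeight_le θ h')
    · exact (hsNorm_le_traceNorm b _).trans (traceNorm_sub_le_oscillation b C hh)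

theorem hsNorm_discretization_le {S : Finset (EuclideanSpace ℝ (Fin d))}
    (hw : AdmissibleWindow (region S) K L ρ Δ R) (hC : CovarianceRegular b C γ)
    (hmesh : 2 * meshSize S ≤ R / 4)
    (hosc : AEMeasurable (oscillation b C (2 * meshSize S)) volume)
    (θ : EuclideanSpace ℝ (Fin d)) :
    hsNorm b (meanSum C S K Δ θ - ∫ h, (character θ h * (K (Δ⁻¹ • h) : ℂ)) • C h) ≤
    ENNReal.ofReal (2 * meshSize S * (2 ^ d * ‖θ‖ + 2 ^ d * L + 4 ^ d * d)) *
        (∫⁻ x, traceNorm b (C x)) +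
      ENNReal.ofReal (2 ^ d) * ∫⁻ x, oscillation b C (2 * meshSize S) x := by
  have hV := hw.volume_pos
  have volume_eq : volume (region S) = ENNReal.ofReal (volume.real (region S)) :=
    (ENNReal.ofReal_toReal (isCompact_region S).measure_ne_top).symm
  have integrable_lagWeight_smul : Integrable (fun h => lagWeight (region S) K Δ θ h • C h) :=
    hC.integrable_covariance.bdd_smul _ (hw.measurable_lagWeight θ).aestronglyMeasurable
      (ae_of_all _ fun h => hw.norm_lagWeight_le θ h)
  rw [meanSum, ← hw.integral_overlap_smul_lagWeight_smul]
  refine (hsNorm_sum_cell_smul_sub_integral_overlap_le S b integrable_lagWeight_smul _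
    fun h h' => hw.hsNorm_lagWeight_smul_sub_le b C hmesh).trans_eq ?_
  rw [lintegral_add_right' _ (hosc.const_mul _), lintegral_const_mul' _ _ ENNReal.ofReal_ne_top,
    lintegral_const_mul' _ _ ENNReal.ofReal_ne_top, mul_add, ← mul_assoc, ← mul_assoc, volume_eq,
    ← ENNReal.ofReal_mul hV.le, ← ENNReal.ofReal_mul hV.le, mul_div_cancel₀ _ hV.ne',
    mul_div_cancel₀ _ hV.ne']

end AdmissibleWindow

end Discretization

section Smoothing

variable {d : ℕ} {K : EuclideanSpace ℝ (Fin d) → ℝ} {Δ : ℝ}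

theorem norm_character_mul_one_sub_le (nonneg : ∀ u, 0 ≤ K u) (le_one : ∀ u, K u ≤ 1)
    (Δ : ℝ) (θ h : EuclideanSpace ℝ (Fin d)) :
    ‖character θ h * ((1 - K (Δ⁻¹ • h) : ℝ) : ℂ)‖ ≤ 1 := by
  rw [norm_mul, norm_character, one_mul, Complex.norm_real, Real.norm_eq_abs, abs_le]
  constructor <;> linarith [nonneg (Δ⁻¹ • h), le_one (Δ⁻¹ • h)]

theorem integral_character_mul_kernel_sub {F : Type*} [NormedAddCommGroup F] [NormedSpace ℂ F]
    {C : EuclideanSpace ℝ (Fin d) → F} (hC : Integrable C) (continuous : Continuous K)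
    (nonneg : ∀ u, 0 ≤ K u) (le_one : ∀ u, K u ≤ 1) (hΔ : 0 < Δ) (θ : EuclideanSpace ℝ (Fin d)) :
    (∫ h, (character θ h * (K (Δ⁻¹ • h) : ℂ)) • C h) - ∫ h, character θ h • C h =
      -((∫ h in Δ • kernelSupport K, (character θ h * ((1 - K (Δ⁻¹ • h) : ℝ) : ℂ)) • C h) +
        ∫ h in (Δ • kernelSupport K)ᶜ, character θ h • C h) := by
  have measurable_support : MeasurableSet (Δ • kernelSupport K) :=
    ((isOpen_lt continuous_const continuous).smul₀ hΔ.ne').measurableSet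
  have continuous_weight : Continuous fun h => character θ h * ((1 - K (Δ⁻¹ • h) : ℝ) : ℂ) :=
    (continuous_character θ).mul (Complex.continuous_ofReal.comp
      (continuous_const.sub (continuous.comp (continuous_const_smul _))))
  have integrable_one_sub :
      Integrable (fun h => (character θ h * ((1 - K (Δ⁻¹ • h) : ℝ) : ℂ)) • C h) :=
    hC.bdd_smul 1 continuous_weight.aestronglyMeasurable
      (ae_of_all _ (norm_character_mul_one_sub_le nonneg le_one Δ θ))
  have integral_compl : ∫ h in (Δ • kernelSupport K)ᶜ, character θ h • C h =
      ∫ h in (Δ • kernelSupport K)ᶜ, (character θ h * ((1 - K (Δ⁻¹ • h) : ℝ) : ℂ)) • C h := by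
    refine setIntegral_congr_fun measurable_support.compl fun h hh => ?_
    have kernel_eq_zero : K (Δ⁻¹ • h) = 0 :=
      le_antisymm (not_lt.1 fun kernel_pos =>
        hh ((Set.mem_smul_set_iff_inv_smul_mem₀ hΔ.ne' _ _).2 kernel_pos)) (nonneg _)
    simp [kernel_eq_zero]
  rw [integral_compl, integral_add_compl measurable_support integrable_one_sub,
    ← sub_sub_cancel_left (∫ h, character θ h • C h),
    ← integral_sub (integrable_character_smul hC θ) integrable_one_sub]
  simp_rw [← sub_smul, Complex.ofReal_sub, Complex.ofReal_one, mul_sub, mul_one, sub_sub_cancel]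

variable {H : Type*} [NormedAddCommGroup H] [InnerProductSpace ℂ H] [CompleteSpace H]
  {ι : Type*} {b : HilbertBasis ι ℂ H} {C : EuclideanSpace ℝ (Fin d) → H →L[ℂ] H}

theorem hsNorm_setIntegral_smul_le {w : EuclideanSpace ℝ (Fin d) → ℂ} (hw : ∀ h, ‖w h‖ ≤ 1)
    (B : Set (EuclideanSpace ℝ (Fin d))) :
    hsNorm b (∫ h in B, w h • C h) ≤ ∫⁻ h, traceNorm b (C h) := by
  refine (hsNorm_integral_le b _ _).trans
    ((setLIntegral_le_lintegral _ _).trans (lintegral_mono fun h => ?_))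
  calc hsNorm b (w h • C h) ≤ ‖w h‖ₑ * hsNorm b (C h) := hsNorm_smul_le b _ _
    _ ≤ ENNReal.ofReal 1 * traceNorm b (C h) :=
        mul_le_mul' (enorm_le_ofReal (hw h)) (hsNorm_le_traceNorm b _)
    _ = traceNorm b (C h) := by rw [ENNReal.ofReal_one, one_mul]

theorem hsNorm_smoothing_le (integrable : Integrable C) (finite : ∫⁻ h, traceNorm b (C h) ≠ ∞)
    (continuous : Continuous K) (nonneg : ∀ u, 0 ≤ K u) (le_one : ∀ u, K u ≤ 1) (hΔ : 0 < Δ)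
    (θ : EuclideanSpace ℝ (Fin d)) :
    hsNorm b ((∫ h, (character θ h * (K (Δ⁻¹ • h) : ℂ)) • C h) - ∫ h, character θ h • C h) ≤
      ENNReal.ofReal (biasB1 b C K Δ θ + biasB2 b C K Δ θ) := by
  rw [integral_character_mul_kernel_sub integrable continuous nonneg le_one hΔ, hsNorm_neg]
  refine (hsNorm_add_le b _ _).trans_eq ?_
  rw [biasB1, biasB2, ENNReal.ofReal_add ENNReal.toReal_nonneg ENNReal.toReal_nonneg,
    ENNReal.ofReal_toReal (ne_top_of_le_ne_top finite (hsNorm_setIntegral_smul_le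
      (norm_character_mul_one_sub_le nonneg le_one Δ θ) _)),
    ENNReal.ofReal_toReal (ne_top_of_le_ne_top finite (hsNorm_setIntegral_smul_le
      (fun h => (norm_character θ h).le) _))]

end Smoothing

section Variance

variable {d : ℕ} {K : EuclideanSpace ℝ (Fin d) → ℝ} {L : ℝ≥0} {ρ Δ R : ℝ}
  {S : Finset (EuclideanSpace ℝ (Fin d))}

/-- The coefficient of `X(t) ⊗ X(s)` in the lag-window estimator, up to the factor `(2π)⁻ᵈ`. -/
noncomputable def pairWeight (S : Finset (EuclideanSpace ℝ (Fin d)))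
    (K : EuclideanSpace ℝ (Fin d) → ℝ) (Δ : ℝ) (θ : EuclideanSpace ℝ (Fin d))
    (p : EuclideanSpace ℝ (Fin d) × EuclideanSpace ℝ (Fin d)) : ℂ :=
  ((volume.real (cell S p.1) * volume.real (cell S p.2) : ℝ) : ℂ) *
    lagWeight (region S) K Δ θ (p.1 - p.2)

variable {H : Type*} [NormedAddCommGroup H] [InnerProductSpace ℂ H]
  {Ω : Type*} [MeasurableSpace Ω]

/-- The deviation of the lag-window estimator from its expectation, up to the factor `(2π)⁻ᵈ`. -/
noncomputable def fluctuation (P : Measure Ω) (X : EuclideanSpace ℝ (Fin d) → Ω → H)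
    (S : Finset (EuclideanSpace ℝ (Fin d))) (K : EuclideanSpace ℝ (Fin d) → ℝ) (Δ : ℝ)
    (θ : EuclideanSpace ℝ (Fin d)) (ω : Ω) : H →L[ℂ] H :=
  ∑ p ∈ S ×ˢ S, pairWeight S K Δ θ p •
    (InnerProductSpace.rankOne ℂ (X p.1 ω) (X p.2 ω) - autocov P X (p.1 - p.2))

theorem enorm_volume_cell (S : Finset (EuclideanSpace ℝ (Fin d)))
    (t : EuclideanSpace ℝ (Fin d)) : ‖volume.real (cell S t)‖ₑ = volume (cell S t) := by
  rw [Real.enorm_of_nonneg measureReal_nonneg, measureReal_def,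
    ENNReal.ofReal_toReal (volume_cell_ne_top S t)]

theorem sum_volume_cell_mul_indicator_closedBall_le (S : Finset (EuclideanSpace ℝ (Fin d)))
    (t : EuclideanSpace ℝ (Fin d)) (r : ℝ) :
    ∑ s ∈ S, volume (cell S s) * (Metric.closedBall t r).indicator 1 s ≤
      volume (Metric.closedBall t (r + meshSize S)) := by
  refine (sum_volume_cell_mul_le S _
    ((Metric.closedBall t (r + meshSize S)).indicator 1) fun s hs y hy => ?_).trans
      ((setLIntegral_le_lintegral _ _).trans_eq
        (lintegral_indicator_one Metric.isClosed_closedBall.measurableSet))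
  by_cases hst : s ∈ Metric.closedBall t r
  · have hyt : y ∈ Metric.closedBall t (r + meshSize S) := by
      rw [Metric.mem_closedBall] at hst ⊢
      linarith [dist_triangle y s t, dist_le_meshSize hs hy]
    rw [Set.indicator_of_mem hst, Set.indicator_of_mem hyt, Pi.one_apply, Pi.one_apply]
  · rw [Set.indicator_of_notMem hst]
    exact bot_le

namespace AdmissibleWindow

theorem enorm_pairWeight_le (hw : AdmissibleWindow (region S) K L ρ Δ R)
    (θ : EuclideanSpace ℝ (Fin d)) (p : EuclideanSpace ℝ (Fin d) × EuclideanSpace ℝ (Fin d)) :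
    ‖pairWeight S K Δ θ p‖ₑ ≤ volume (cell S p.1) * volume (cell S p.2) *
      (ENNReal.ofReal (2 ^ d / volume.real (region S)) *
        (Metric.closedBall p.1 (ρ * Δ)).indicator 1 p.2) := by
  have enorm_volumes : ‖((volume.real (cell S p.1) * volume.real (cell S p.2) : ℝ) : ℂ)‖ₑ =
      volume (cell S p.1) * volume (cell S p.2) := by
    rw [enorm_complex_ofReal, enorm_mul, enorm_volume_cell, enorm_volume_cell]
  rw [pairWeight, enorm_mul, enorm_volumes]
  gcongr
  by_cases hp : p.2 ∈ Metric.closedBall p.1 (ρ * Δ)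
  · rw [Set.indicator_of_mem hp, Pi.one_apply, mul_one]
    exact enorm_le_ofReal (hw.norm_lagWeight_le θ _)
  · rw [Metric.mem_closedBall, not_le, dist_comm, dist_eq_norm] at hp
    rw [hw.lagWeight_eq_zero hp, enorm_zero]
    exact bot_le

theorem sum_enorm_pairWeight_le (hw : AdmissibleWindow (region S) K L ρ Δ R)
    (hρ : 0 ≤ ρ) (hmesh : meshSize S ≤ Δ) (θ : EuclideanSpace ℝ (Fin d)) :
    ∑ p ∈ S ×ˢ S, ‖pairWeight S K Δ θ p‖ₑ ≤
      ENNReal.ofReal (2 ^ d) * (ENNReal.ofReal (((ρ + 1) * Δ) ^ d) *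
        volume (Metric.ball (0 : EuclideanSpace ℝ (Fin d)) 1)) := by
  have radius_nonneg : 0 ≤ (ρ + 1) * Δ := mul_nonneg (by linarith) hw.bandwidth_pos.le
  have volume_near_le (t : EuclideanSpace ℝ (Fin d)) :
      ∑ s ∈ S, volume (cell S s) * (Metric.closedBall t (ρ * Δ)).indicator 1 s ≤
        ENNReal.ofReal (((ρ + 1) * Δ) ^ d) *
          volume (Metric.ball (0 : EuclideanSpace ℝ (Fin d)) 1) := by
    calc _ ≤ volume (Metric.closedBall t (ρ * Δ + meshSize S)) :=
          sum_volume_cell_mul_indicator_closedBall_le S t (ρ * Δ)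
      _ ≤ volume (Metric.closedBall t ((ρ + 1) * Δ)) :=
          measure_mono (Metric.closedBall_subset_closedBall (by linarith))
      _ = _ := by
          rw [Measure.addHaar_closedBall _ _ radius_nonneg, finrank_euclideanSpace,
            Fintype.card_fin]
  have volume_eq : volume (region S) = ENNReal.ofReal (volume.real (region S)) :=
    (ENNReal.ofReal_toReal (isCompact_region S).measure_ne_top).symm
  calc ∑ p ∈ S ×ˢ S, ‖pairWeight S K Δ θ p‖ₑ
      ≤ ∑ t ∈ S, volume (cell S t) * (ENNReal.ofReal (2 ^ d / volume.real (region S)) *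
          ∑ s ∈ S, volume (cell S s) * (Metric.closedBall t (ρ * Δ)).indicator 1 s) := by
        simp_rw [Finset.mul_sum]
        rw [Finset.sum_product]
        refine Finset.sum_le_sum fun t _ => Finset.sum_le_sum fun s _ =>
          (hw.enorm_pairWeight_le θ (t, s)).trans_eq ?_
        ring
    _ ≤ ∑ t ∈ S, volume (cell S t) * (ENNReal.ofReal (2 ^ d / volume.real (region S)) *
          (ENNReal.ofReal (((ρ + 1) * Δ) ^ d) *
            volume (Metric.ball (0 : EuclideanSpace ℝ (Fin d)) 1))) := by
        gcongr with t
        exact volume_near_le t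
    _ = _ := by
        rw [← Finset.sum_mul, sum_volume_cell, volume_eq, ← mul_assoc,
          ← ENNReal.ofReal_mul hw.volume_pos.le, mul_div_cancel₀ _ hw.volume_pos.ne']

theorem sum_enorm_pairWeight_mul_le (hw : AdmissibleWindow (region S) K L ρ Δ R)
    (θ : EuclideanSpace ℝ (Fin d)) (f g : EuclideanSpace ℝ (Fin d) → ℝ≥0∞) {A : ℝ≥0∞}
    (hf : ∑ t ∈ S, volume (cell S t) * f t ≤ A) (hg : ∑ s ∈ S, volume (cell S s) * g s ≤ A) :
    ∑ q ∈ S ×ˢ S, ‖pairWeight S K Δ θ q‖ₑ * (f q.1 * g q.2) ≤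
      ENNReal.ofReal (2 ^ d / volume.real (region S)) * A ^ 2 := by
  calc ∑ q ∈ S ×ˢ S, ‖pairWeight S K Δ θ q‖ₑ * (f q.1 * g q.2)
      ≤ ∑ q ∈ S ×ˢ S, (volume (cell S q.1) * volume (cell S q.2) *
          (ENNReal.ofReal (2 ^ d / volume.real (region S)) * 1)) * (f q.1 * g q.2) := by
        gcongr with q
        exact (hw.enorm_pairWeight_le θ q).trans
          (by gcongr; exact Set.indicator_le_self' (fun _ _ => bot_le) _)
    _ = ENNReal.ofReal (2 ^ d / volume.real (region S)) *
          ((∑ t ∈ S, volume (cell S t) * f t) * ∑ s ∈ S, volume (cell S s) * g s) := by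
        rw [Finset.sum_mul_sum, ← Finset.sum_product', Finset.mul_sum]
        exact Finset.sum_congr rfl fun q _ => by ring
    _ ≤ ENNReal.ofReal (2 ^ d / volume.real (region S)) * A ^ 2 := by
        rw [sq]
        gcongr

variable [CompleteSpace H] {ι : Type*}

theorem sum_enorm_pairWeight_mul_covariances_le (hw : AdmissibleWindow (region S) K L ρ Δ R)
    (θ : EuclideanSpace ℝ (Fin d)) (b : HilbertBasis ι ℂ H)
    (C : EuclideanSpace ℝ (Fin d) → H →L[ℂ] H) (t s : EuclideanSpace ℝ (Fin d)) :
    ∑ q ∈ S ×ˢ S, ‖pairWeight S K Δ θ q‖ₑ *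
        (diagNorm b (C (t - q.1)) * diagNorm b (C (s - q.2)) +
          hsNorm b (C (t - q.2)) * hsNorm b (C (s - q.1))) ≤
      2 * (ENNReal.ofReal (2 ^ d / volume.real (region S)) *
        covarianceMass b C (meshSize S) ^ 2) := by
  have hs_le (T : H →L[ℂ] H) : hsNorm b T ≤ crossNorm b T := le_self_add
  have diag_le (T : H →L[ℂ] H) : diagNorm b T ≤ crossNorm b T := le_add_self
  have cross_le (t s : EuclideanSpace ℝ (Fin d)) :=
    hw.sum_enorm_pairWeight_mul_le θ (fun r => crossNorm b (C (t - r)))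
      (fun r => crossNorm b (C (s - r))) (sum_volume_cell_mul_crossNorm_le S b C t)
      (sum_volume_cell_mul_crossNorm_le S b C s)
  calc _ ≤ ∑ q ∈ S ×ˢ S,
        (‖pairWeight S K Δ θ q‖ₑ * (crossNorm b (C (t - q.1)) * crossNorm b (C (s - q.2))) +
          ‖pairWeight S K Δ θ q‖ₑ * (crossNorm b (C (s - q.1)) * crossNorm b (C (t - q.2)))) := by
        refine Finset.sum_le_sum fun q _ => ?_
        rw [← mul_add, mul_comm (hsNorm b (C (t - q.2)))]
        gcongr
        exacts [diag_le _, diag_le _, hs_le _, hs_le _]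
    _ ≤ _ := by
        rw [Finset.sum_add_distrib, two_mul]
        exact add_le_add (cross_le t s) (cross_le s t)

end AdmissibleWindow

variable [CompleteSpace H] {ι : Type*} {b : HilbertBasis ι ℂ H}
  [TopologicalSpace.SeparableSpace H] [MeasurableSpace H] [BorelSpace H]
  {P : Measure Ω} {X : EuclideanSpace ℝ (Fin d) → Ω → H}

theorem IsStationaryGaussian.variance_le (hX : IsStationaryGaussian P b X)
    (hw : AdmissibleWindow (region S) K L ρ Δ R) (hρ : 0 ≤ ρ) (hmesh : meshSize S ≤ Δ)
    (θ : EuclideanSpace ℝ (Fin d)) :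
    ∫⁻ ω, hsNorm b (fluctuation P X S K Δ θ ω) ^ 2 ∂P ≤
      2 * volume (Metric.ball (0 : EuclideanSpace ℝ (Fin d)) 1) *
        covarianceMass b (autocov P X) (meshSize S) ^ 2 *
        ENNReal.ofReal (4 ^ d * (ρ + 1) ^ d * (Δ ^ d / volume.real (region S))) := by
  set C := autocov P X
  set A := covarianceMass b C (meshSize S)
  have radius_nonneg : 0 ≤ (ρ + 1) * Δ := mul_nonneg (by linarith) hw.bandwidth_pos.le
  have constant_eq : (4 : ℝ) ^ d * (ρ + 1) ^ d * (Δ ^ d / volume.real (region S)) =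
      2 ^ d * (((ρ + 1) * Δ) ^ d * (2 ^ d / volume.real (region S))) := by
    rw [show (4 : ℝ) = 2 * 2 by norm_num, mul_pow, mul_pow]
    ring
  calc _ ≤ ∑ p ∈ S ×ˢ S, ∑ q ∈ S ×ˢ S, ‖pairWeight S K Δ θ p‖ₑ * ‖pairWeight S K Δ θ q‖ₑ *
        (diagNorm b (C (p.1 - q.1)) * diagNorm b (C (p.2 - q.2)) +
          hsNorm b (C (p.1 - q.2)) * hsNorm b (C (p.2 - q.1))) :=
        hX.lintegral_hsNorm_sq_le (S ×ˢ S) Prod.fst Prod.snd (pairWeight S K Δ θ)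
    _ ≤ ∑ p ∈ S ×ˢ S, ‖pairWeight S K Δ θ p‖ₑ *
          (2 * (ENNReal.ofReal (2 ^ d / volume.real (region S)) * A ^ 2)) := by
        refine Finset.sum_le_sum fun p _ => ?_
        simp_rw [mul_assoc, ← Finset.mul_sum]
        gcongr
        exact hw.sum_enorm_pairWeight_mul_covariances_le θ b C p.1 p.2
    _ ≤ ENNReal.ofReal (2 ^ d) * (ENNReal.ofReal (((ρ + 1) * Δ) ^ d) *
          volume (Metric.ball (0 : EuclideanSpace ℝ (Fin d)) 1)) *
          (2 * (ENNReal.ofReal (2 ^ d / volume.real (region S)) * A ^ 2)) := by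
        rw [← Finset.sum_mul]
        exact mul_le_mul_left (hw.sum_enorm_pairWeight_le hρ hmesh θ) _
    _ = _ := by
        rw [constant_eq, ENNReal.ofReal_mul (by positivity), ENNReal.ofReal_mul (by positivity)]
        ring

end Variance

section Compression

variable {H : Type*} [NormedAddCommGroup H] [InnerProductSpace ℂ H]

/-- The compression `T ↦ Q T Q` as a continuous linear map, which therefore commutes with
expectations and integrals. -/
noncomputable def compressCLM (Q : H →L[ℂ] H) : (H →L[ℂ] H) →L[ℂ] (H →L[ℂ] H) :=
  (ContinuousLinearMap.compL ℂ H H H Q) ∘L (ContinuousLinearMap.compL ℂ H H H).flip Q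

theorem compressCLM_apply (Q T : H →L[ℂ] H) : compressCLM Q T = compress Q T := rfl

variable [CompleteSpace H] {d : ℕ} {Ω : Type*} [MeasurableSpace Ω]

theorem compress_rankOne {Q : H →L[ℂ] H} (hQ : IsSelfAdjoint Q) (x y : H) :
    compress Q (InnerProductSpace.rankOne ℂ x y) = InnerProductSpace.rankOne ℂ (Q x) (Q y) := by
  ext z
  have inner_apply : inner ℂ (Q y) z = inner ℂ y (Q z) := hQ.isSymmetric y z
  simp [compress, inner_apply]

theorem spectralDensity_compress {C : EuclideanSpace ℝ (Fin d) → H →L[ℂ] H} (hC : Integrable C)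
    (Q : H →L[ℂ] H) (θ : EuclideanSpace ℝ (Fin d)) :
    spectralDensity (fun h => compress Q (C h)) θ = compress Q (spectralDensity C θ) := by
  rw [spectralDensity, spectralDensity, ← compressCLM_apply, map_smul,
    ← ContinuousLinearMap.integral_comp_comm _ (integrable_character_smul hC θ)]
  simp_rw [map_smul, compressCLM_apply]

variable {ι : Type*} {b : HilbertBasis ι ℂ H}
  [TopologicalSpace.SeparableSpace H] [MeasurableSpace H] [BorelSpace H]
  {P : Measure Ω} {X : EuclideanSpace ℝ (Fin d) → Ω → H}

theorem IsStationaryGaussian.autocov_compress (hX : IsStationaryGaussian P b X)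
    {Q : H →L[ℂ] H} (hQ : IsSelfAdjoint Q) :
    autocov P (fun t ω => Q (X t ω)) = fun h => compress Q (autocov P X h) := by
  ext1 h
  rw [autocov, autocov, covOp, covOp, ← compressCLM_apply,
    ← ContinuousLinearMap.integral_comp_comm _ (hX.integrable_rankOne h 0)]
  simp_rw [compressCLM_apply, compress_rankOne hQ]

end Compression

section Estimator

variable {d : ℕ} {H : Type*} [NormedAddCommGroup H] [InnerProductSpace ℂ H]
  {Ω : Type*} [MeasurableSpace Ω] {P : Measure Ω} {X : EuclideanSpace ℝ (Fin d) → Ω → H}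
  {K : EuclideanSpace ℝ (Fin d) → ℝ} {Δ : ℝ} {S : Finset (EuclideanSpace ℝ (Fin d))}

theorem estimator_sub_spectralDensity (P : Measure Ω) (X : EuclideanSpace ℝ (Fin d) → Ω → H)
    (S : Finset (EuclideanSpace ℝ (Fin d))) (K : EuclideanSpace ℝ (Fin d) → ℝ) (Δ : ℝ)
    (θ : EuclideanSpace ℝ (Fin d)) (ω : Ω) :
    estimator X S K Δ θ ω - spectralDensity (autocov P X) θ = (((2 * Real.pi) ^ d)⁻¹ : ℂ) •
      (fluctuation P X S K Δ θ ω +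
        (meanSum (autocov P X) S K Δ θ - ∫ h, character θ h • autocov P X h)) := by
  rw [estimator, spectralDensity, ← smul_sub, ← add_sub_assoc, fluctuation, meanSum,
    ← Finset.sum_product', ← Finset.sum_product', ← Finset.sum_add_distrib]
  congr 2
  refine Finset.sum_congr rfl fun p _ => ?_
  rw [← Complex.coe_smul, smul_smul, ← pairWeight, ← smul_add, sub_add_cancel, pairWeight,
    lagWeight, overlap]
  congr 1
  push_cast
  ring

theorem enorm_normalization_le (d : ℕ) : ‖(((2 * Real.pi) ^ d)⁻¹ : ℂ)‖ₑ ≤ 1 := by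
  rw [← ofReal_norm, norm_inv, norm_pow, norm_mul, Complex.norm_real, RCLike.norm_ofNat,
    Real.norm_of_nonneg Real.pi_pos.le]
  exact ENNReal.ofReal_le_one.2
    (inv_le_one_of_one_le₀ (one_le_pow₀ (by linarith [Real.pi_gt_three])))

variable {ι : Type*} {b : HilbertBasis ι ℂ H}

theorem add_sq_le_two_mul_add_sq (x y : ℝ≥0∞) : (x + y) ^ 2 ≤ 2 * (x ^ 2 + y ^ 2) := by
  simpa only [ENNReal.rpow_two, show (2 : ℝ) - 1 = 1 by norm_num, ENNReal.rpow_one] using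
    ENNReal.rpow_add_le_mul_rpow_add_rpow x y one_le_two

theorem rootMeanSquare_sq (A : Ω → H →L[ℂ] H) :
    rootMeanSquare P b A ^ 2 = ∫⁻ ω, hsNorm b (A ω) ^ 2 ∂P := by
  rw [rootMeanSquare, ← ENNReal.rpow_natCast, ← ENNReal.rpow_mul]
  norm_num

theorem rootMeanSquare_le_of_forall_hsNorm_le_add [IsProbabilityMeasure P]
    {A B : Ω → H →L[ℂ] H} {c : ℝ≥0∞} (h : ∀ ω, hsNorm b (A ω) ≤ hsNorm b (B ω) + c) :
    rootMeanSquare P b A ≤ 2 * (rootMeanSquare P b B + c) := by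
  rw [← ENNReal.pow_le_pow_left_iff two_ne_zero, rootMeanSquare_sq]
  calc ∫⁻ ω, hsNorm b (A ω) ^ 2 ∂P ≤ ∫⁻ ω, 2 * (hsNorm b (B ω) ^ 2 + c ^ 2) ∂P :=
        lintegral_mono fun ω => (pow_le_pow_left' (h ω) 2).trans (add_sq_le_two_mul_add_sq _ _)
    _ = 2 * (rootMeanSquare P b B ^ 2 + c ^ 2) := by
        rw [lintegral_const_mul' _ _ ENNReal.ofNat_ne_top, lintegral_add_right _ measurable_const,
          lintegral_const, measure_univ, mul_one, rootMeanSquare_sq]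
    _ ≤ 4 * (rootMeanSquare P b B + c) ^ 2 := by
        gcongr
        · norm_num
        · rw [add_sq]
          gcongr
          exact le_self_add
    _ = (2 * (rootMeanSquare P b B + c)) ^ 2 := by ring

variable [CompleteSpace H]

theorem rootMeanSquare_compress_estimator_sub_le [IsProbabilityMeasure P] {Q : H →L[ℂ] H}
    (hQ : ‖Q‖ ≤ 1) (θ : EuclideanSpace ℝ (Fin d)) :
    rootMeanSquare P b (fun ω => compress Q (estimator X S K Δ θ ω) -
        compress Q (spectralDensity (autocov P X) θ)) ≤
      2 * (rootMeanSquare P b (fluctuation P X S K Δ θ) +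
        hsNorm b (meanSum (autocov P X) S K Δ θ - ∫ h, character θ h • autocov P X h)) := by
  refine rootMeanSquare_le_of_forall_hsNorm_le_add fun ω => ?_
  have hQ' : ‖Q‖ₑ ≤ 1 := (enorm_le_ofReal hQ).trans_eq ENNReal.ofReal_one
  rw [← compressCLM_apply, ← compressCLM_apply, ← map_sub, compressCLM_apply,
    estimator_sub_spectralDensity]
  calc _ ≤ _ := (hsNorm_compress_le b hQ' _).trans (hsNorm_smul_le b _ _)
    _ ≤ _ := mul_le_of_le_one_left' (enorm_normalization_le d)
    _ ≤ _ := hsNorm_add_le b _ _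

end Estimator

section Asymptotics

variable {d : ℕ}

theorem two_mul_ofReal_add_le {v β x y : ℝ} (hv : 0 ≤ v) (hβ : 0 ≤ β) (hx : 0 ≤ x) (hy : 0 ≤ y) :
    2 * (ENNReal.ofReal (v * x) + ENNReal.ofReal (β * y)) ≤
      ENNReal.ofReal (2 * (v + β) * (y + x)) := by
  rw [← ENNReal.ofReal_add (by positivity) (by positivity), ← ENNReal.ofReal_ofNat,
    ← ENNReal.ofReal_mul zero_le_two]
  refine ENNReal.ofReal_le_ofReal ?_
  nlinarith [mul_nonneg hv hy, mul_nonneg hβ hx]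

theorem le_mul_rpow_of_pow_div_le (hd : 0 < d) {x v c : ℝ} (hv : 0 < v) (hc : 0 ≤ c)
    (h : x ^ d / v ≤ c ^ d) : x ≤ c * v ^ (1 / d : ℝ) := by
  have hd' : (0 : ℝ) < d := by exact_mod_cast hd
  refine le_of_pow_le_pow_left₀ hd.ne' (by positivity) ?_
  rwa [mul_pow, ← Real.rpow_natCast (v ^ (1 / d : ℝ)), ← Real.rpow_mul hv.le,
    one_div_mul_cancel hd'.ne', Real.rpow_one, ← div_le_iff₀ hv]

namespace SamplingDesign

variable {S : ℕ → Finset (EuclideanSpace ℝ (Fin d))}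

theorem tendsto_meshSize_nhdsGT (hS : SamplingDesign S) :
    Tendsto (fun n => meshSize (S n)) atTop (𝓝[>] 0) := by
  have : Nonempty (Fin d) := ⟨⟨0, hS.dim_pos⟩⟩
  exact tendsto_nhdsWithin_iff.2 ⟨hS.mesh,
    (hS.volume_tendsto.eventually_gt_atTop 0).mono fun n hn => meshSize_pos hn⟩

theorem eventually_admissibleWindow (hS : SamplingDesign S) {K : EuclideanSpace ℝ (Fin d) → ℝ}
    {L : ℝ≥0} (lipschitz : LipschitzWith L K) (nonneg : ∀ u, 0 ≤ K u) (le_one : ∀ u, K u ≤ 1)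
    {ρ : ℝ} (hρ : 0 < ρ) (support : ∀ u, K u ≠ 0 → ‖u‖ ≤ ρ)
    {Δ : ℕ → ℝ} (one_le_bandwidth : ∀ᶠ n in atTop, 1 ≤ Δ n)
    (hΔ : Tendsto (fun n => Δ n ^ d / volume.real (region (S n))) atTop (𝓝 0)) :
    ∃ R : ℕ → ℝ, ∀ᶠ n in atTop, AdmissibleWindow (region (S n)) K L ρ (Δ n) (R n) := by
  obtain ⟨r, hr, ball_subset⟩ := hS.exists_closedBall_subset
  have hd : (0 : ℝ) < d := by exact_mod_cast hS.dim_pos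
  have radius_tendsto :
      Tendsto (fun n => r * volume.real (region (S n)) ^ (1 / d : ℝ)) atTop atTop :=
    ((tendsto_rpow_atTop (one_div_pos.2 hd)).comp hS.volume_tendsto).const_mul_atTop hr
  have bandwidth_small : ∀ᶠ n in atTop,
      Δ n ^ d / volume.real (region (S n)) < (r / (4 * ρ)) ^ d :=
    hΔ.eventually_lt_const (by positivity)
  refine ⟨fun n => r * volume.real (region (S n)) ^ (1 / d : ℝ), ?_⟩
  filter_upwards [ball_subset, radius_tendsto.eventually_ge_atTop 1, one_le_bandwidth,
    hS.volume_tendsto.eventually_gt_atTop 0, bandwidth_small]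
    with n ball_subset one_le_radius one_le_bandwidth volume_pos bandwidth_small
  refine ⟨convex_region _, isCompact_region _, ball_subset, volume_pos, one_le_radius,
    one_le_bandwidth, ?_, support, lipschitz, nonneg, le_one⟩
  calc ρ * Δ n ≤ ρ * (r / (4 * ρ) * volume.real (region (S n)) ^ (1 / d : ℝ)) := by
        gcongr
        exact le_mul_rpow_of_pow_div_le hS.dim_pos volume_pos (by positivity) bandwidth_small.le
    _ = r * volume.real (region (S n)) ^ (1 / d : ℝ) / 4 := by field_simp

end SamplingDesign

variable {H : Type*} [NormedAddCommGroup H] [InnerProductSpace ℂ H] [CompleteSpace H]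
  {ι : Type*} {b : HilbertBasis ι ℂ H} {C : EuclideanSpace ℝ (Fin d) → H →L[ℂ] H} {γ : ℝ}

namespace CovarianceRegular

theorem exists_eventually_lintegral_oscillation_le (hC : CovarianceRegular b C γ) :
    ∃ M : ℝ, 0 ≤ M ∧ ∀ᶠ δ in 𝓝[>] 0, AEMeasurable (oscillation b C δ) volume ∧
      ∫⁻ x, oscillation b C δ x ≤ ENNReal.ofReal (M * δ ^ γ) := by
  obtain ⟨-, -, M, δ₀, hδ₀, holder⟩ := hC.holder
  refine ⟨|M|, abs_nonneg M, ?_⟩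
  filter_upwards [Ioc_mem_nhdsGT hδ₀] with δ ⟨hδ, hδ_le⟩
  refine ⟨(holder δ hδ hδ_le).1, (holder δ hδ hδ_le).2.trans (ENNReal.ofReal_le_ofReal ?_)⟩
  gcongr
  exact le_abs_self M

theorem exists_eventually_covarianceMass_le (hC : CovarianceRegular b C γ) :
    ∃ A : ℝ, 0 ≤ A ∧ ∀ᶠ δ in 𝓝[>] 0, covarianceMass b C δ ≤ ENNReal.ofReal A := by
  obtain ⟨M, hM, oscillation_le⟩ := hC.exists_eventually_lintegral_oscillation_le
  refine ⟨2 * ((∫⁻ h, traceNorm b (C h)).toReal + M), by positivity, ?_⟩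
  filter_upwards [oscillation_le, Ioo_mem_nhdsGT one_pos]
    with δ ⟨measurable, oscillation_le⟩ ⟨hδ, hδ_lt⟩
  rw [covarianceMass, lintegral_const_mul' _ _ ENNReal.ofNat_ne_top,
    lintegral_add_right' _ measurable, ENNReal.ofReal_mul zero_le_two, ENNReal.ofReal_ofNat,
    ENNReal.ofReal_add ENNReal.toReal_nonneg hM, ENNReal.ofReal_toReal hC.integrable.ne]
  gcongr
  refine oscillation_le.trans (ENNReal.ofReal_le_ofReal (mul_le_of_le_one_right hM ?_))
  exact Real.rpow_le_one hδ.le hδ_lt.le hC.holder.1.le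

end CovarianceRegular

section Rates

variable {S : ℕ → Finset (EuclideanSpace ℝ (Fin d))} {K : EuclideanSpace ℝ (Fin d) → ℝ}
  {L : ℝ≥0} {ρ : ℝ} {Δ R : ℕ → ℝ}

theorem CovarianceRegular.exists_eventually_hsNorm_discretization_le
    (hC : CovarianceRegular b C γ)
    (hmesh : Tendsto (fun n => meshSize (S n)) atTop (𝓝[>] 0))
    (hw : ∀ᶠ n in atTop, AdmissibleWindow (region (S n)) K L ρ (Δ n) (R n))
    {Θ : Set (EuclideanSpace ℝ (Fin d))} (hΘ : Bornology.IsBounded Θ) :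
    ∃ β : ℝ, 0 ≤ β ∧ ∀ᶠ n in atTop, ∀ θ ∈ Θ,
      hsNorm b (meanSum C (S n) K (Δ n) θ - ∫ h, (character θ h * (K ((Δ n)⁻¹ • h) : ℂ)) • C h) ≤
        ENNReal.ofReal (β * meshSize (S n) ^ γ) := by
  obtain ⟨M, hM, oscillation_le⟩ := hC.exists_eventually_lintegral_oscillation_le
  obtain ⟨B, hB, norm_le⟩ := hΘ.exists_pos_norm_le
  set τ := (∫⁻ h, traceNorm b (C h)).toReal
  have lintegral_traceNorm : ∫⁻ h, traceNorm b (C h) = ENNReal.ofReal τ :=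
    (ENNReal.ofReal_toReal hC.integrable.ne).symm
  have two_mul_mesh : Tendsto (fun n => 2 * meshSize (S n)) atTop (𝓝[>] 0) := by
    simpa only [mul_zero] using TendstoNhdsWithinIoi.const_mul two_pos hmesh
  refine ⟨2 * (2 ^ d * B + 2 ^ d * L + 4 ^ d * d) * τ + 2 ^ d * (M * 2 ^ γ), by positivity, ?_⟩
  filter_upwards [hw, two_mul_mesh.eventually oscillation_le,
    hmesh.eventually (Ioo_mem_nhdsGT (by norm_num : (0 : ℝ) < 1 / 8))]
    with n hw ⟨measurable, oscillation_le⟩ ⟨mesh_pos, mesh_lt⟩ θ hθ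
  have mesh_le_rpow : meshSize (S n) ≤ meshSize (S n) ^ γ :=
    Real.self_le_rpow_of_le_one mesh_pos.le (by linarith) hC.holder.2.1
  refine (hw.hsNorm_discretization_le hC (by linarith [hw.one_le_radius]) measurable θ).trans ?_
  rw [add_mul, ENNReal.ofReal_add (by positivity) (by positivity), lintegral_traceNorm,
    ← ENNReal.ofReal_mul (by positivity), mul_assoc (2 ^ d),
    ENNReal.ofReal_mul (p := 2 ^ d) (by positivity), mul_assoc M,
    ← Real.mul_rpow zero_le_two mesh_pos.le]
  refine add_le_add (ENNReal.ofReal_le_ofReal ?_) (by gcongr)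
  calc 2 * meshSize (S n) * (2 ^ d * ‖θ‖ + 2 ^ d * L + 4 ^ d * d) * τ
      ≤ 2 * meshSize (S n) ^ γ * (2 ^ d * B + 2 ^ d * L + 4 ^ d * d) * τ := by
        gcongr
        exact norm_le θ hθ
    _ = _ := by ring

theorem CovarianceRegular.exists_eventually_hsNorm_bias_le
    (hC : CovarianceRegular b C γ)
    (hmesh : Tendsto (fun n => meshSize (S n)) atTop (𝓝[>] 0))
    (hw : ∀ᶠ n in atTop, AdmissibleWindow (region (S n)) K L ρ (Δ n) (R n))
    {Θ : Set (EuclideanSpace ℝ (Fin d))} (hΘ : Bornology.IsBounded Θ) :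
    ∃ β : ℝ, 0 ≤ β ∧ ∀ᶠ n in atTop, ∀ θ ∈ Θ,
      hsNorm b (meanSum C (S n) K (Δ n) θ - ∫ h, character θ h • C h) ≤
        ENNReal.ofReal
          (β * (meshSize (S n) ^ γ + biasB1 b C K (Δ n) θ + biasB2 b C K (Δ n) θ)) := by
  obtain ⟨β, hβ, discretization_le⟩ :=
    hC.exists_eventually_hsNorm_discretization_le hmesh hw hΘ
  refine ⟨β + 1, by positivity, ?_⟩
  filter_upwards [hw, discretization_le] with n hw discretization_le θ hθ
  have smoothing_le := hsNorm_smoothing_le hC.integrable_covariance hC.integrable.ne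
    hw.lipschitz.continuous hw.nonneg hw.le_one hw.bandwidth_pos θ
  have mesh_nonneg : 0 ≤ meshSize (S n) ^ γ := Real.rpow_nonneg (meshSize_nonneg _) γ
  have hB₁ : 0 ≤ biasB1 b C K (Δ n) θ := ENNReal.toReal_nonneg
  have hB₂ : 0 ≤ biasB2 b C K (Δ n) θ := ENNReal.toReal_nonneg
  rw [← sub_add_sub_cancel (meanSum C (S n) K (Δ n) θ)
    (∫ h, (character θ h * (K ((Δ n)⁻¹ • h) : ℂ)) • C h)]
  refine (hsNorm_add_le b _ _).trans ((add_le_add (discretization_le θ hθ) smoothing_le).trans ?_)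
  rw [← ENNReal.ofReal_add (by positivity) (by positivity)]
  refine ENNReal.ofReal_le_ofReal ?_
  nlinarith

variable [TopologicalSpace.SeparableSpace H] [MeasurableSpace H] [BorelSpace H]
  {Ω : Type*} [MeasurableSpace Ω] {P : Measure Ω} {X : EuclideanSpace ℝ (Fin d) → Ω → H}

theorem IsStationaryGaussian.exists_eventually_rootMeanSquare_fluctuation_le
    (hX : IsStationaryGaussian P b X) (hC : CovarianceRegular b (autocov P X) γ)
    (hmesh : Tendsto (fun n => meshSize (S n)) atTop (𝓝[>] 0)) (hρ : 0 ≤ ρ)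
    (hw : ∀ᶠ n in atTop, AdmissibleWindow (region (S n)) K L ρ (Δ n) (R n)) :
    ∃ v : ℝ, 0 ≤ v ∧ ∀ᶠ n in atTop, ∀ θ,
      rootMeanSquare P b (fluctuation P X (S n) K (Δ n) θ) ≤
        ENNReal.ofReal (v * √(Δ n ^ d / volume.real (region (S n)))) := by
  obtain ⟨A, hA, mass_le⟩ := hC.exists_eventually_covarianceMass_le
  set κ := volume.real (Metric.ball (0 : EuclideanSpace ℝ (Fin d)) 1)
  have volume_ball : volume (Metric.ball (0 : EuclideanSpace ℝ (Fin d)) 1) = ENNReal.ofReal κ :=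
    (ENNReal.ofReal_toReal measure_ball_lt_top.ne).symm
  refine ⟨√(2 * κ * A ^ 2 * (4 ^ d * (ρ + 1) ^ d)), Real.sqrt_nonneg _, ?_⟩
  filter_upwards [hw, hmesh.eventually mass_le, hmesh.eventually (Ioo_mem_nhdsGT one_pos)]
    with n hw mass_le ⟨_, mesh_lt⟩ θ
  have hV := hw.volume_pos
  have hΔ := hw.bandwidth_pos
  rw [← ENNReal.pow_le_pow_left_iff two_ne_zero, rootMeanSquare_sq,
    ← ENNReal.ofReal_pow (by positivity), mul_pow, Real.sq_sqrt (by positivity),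
    Real.sq_sqrt (by positivity)]
  calc _ ≤ _ := hX.variance_le hw hρ (mesh_lt.le.trans hw.one_le_bandwidth) θ
    _ ≤ 2 * ENNReal.ofReal κ * ENNReal.ofReal A ^ 2 *
          ENNReal.ofReal (4 ^ d * (ρ + 1) ^ d * (Δ n ^ d / volume.real (region (S n)))) := by
        rw [volume_ball]
        gcongr
    _ = _ := by
        rw [mul_assoc (2 * κ * A ^ 2), ENNReal.ofReal_mul (p := 2 * κ * A ^ 2) (by positivity),
          ENNReal.ofReal_mul (p := 2 * κ) (by positivity),
          ENNReal.ofReal_mul (p := 2) (q := κ) zero_le_two, ENNReal.ofReal_pow hA,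
          ENNReal.ofReal_ofNat]

end Rates

end Asymptotics

end SpectralRKHS

theorem mainTheorem10_general
    {d : ℕ}
    {H : Type*} [NormedAddCommGroup H] [InnerProductSpace ℂ H] [CompleteSpace H]
    [TopologicalSpace.SeparableSpace H] [MeasurableSpace H] [BorelSpace H]
    {ι : Type*} (b : HilbertBasis ι ℂ H)
    {Ω : Type*} [MeasurableSpace Ω] (P : Measure Ω)
    (X : EuclideanSpace ℝ (Fin d) → Ω → H) (hX : IsStationaryGaussian P b X)
    (γ : ℝ) (hC : CovarianceRegular b (autocov P X) γ)
    (K : EuclideanSpace ℝ (Fin d) → ℝ) (nonneg : ∀ u, 0 ≤ K u) (le_one : ∀ u, K u ≤ 1)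
    (bounded_support : Bornology.IsBounded (kernelSupport K))
    (L : ℝ≥0) (lipschitz : LipschitzWith L K)
    (S : ℕ → Finset (EuclideanSpace ℝ (Fin d))) (hS : SamplingDesign S)
    (Q : ℕ → H →L[ℂ] H) (hQ : ∀ n, IsSelfAdjoint (Q n)) (norm_le_one : ∀ n, ‖Q n‖ ≤ 1)
    (Δ : ℕ → ℝ) (one_le_bandwidth : ∀ᶠ n in atTop, 1 ≤ Δ n)
    (hΔ : Tendsto (fun n => Δ n ^ d / volume.real (region (S n))) atTop (𝓝 0)) :
    (∀ n θ, spectralDensity (autocov P fun t ω => Q n (X t ω)) θ =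
      compress (Q n) (spectralDensity (autocov P X) θ)) ∧
    ∀ Θ : Set (EuclideanSpace ℝ (Fin d)), Bornology.IsBounded Θ →
      ∃ c : ℝ, ∀ᶠ n in atTop, ∀ θ ∈ Θ,
        rootMeanSquare P b (fun ω => compress (Q n) (estimator X (S n) K (Δ n) θ ω) -
          spectralDensity (autocov P fun t ω' => Q n (X t ω')) θ) ≤
        ENNReal.ofReal (c * (meshSize (S n) ^ γ +
          biasB1 b (autocov P X) K (Δ n) θ + biasB2 b (autocov P X) K (Δ n) θ +
          √(Δ n ^ d / volume.real (region (S n))))) := by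
  have density_eq (n θ) : spectralDensity (autocov P fun t ω => Q n (X t ω)) θ =
      compress (Q n) (spectralDensity (autocov P X) θ) := by
    rw [hX.autocov_compress (hQ n), spectralDensity_compress hC.integrable_covariance]
  refine ⟨density_eq, fun Θ hΘ => ?_⟩
  have := hX.gaussian.isProbabilityMeasure
  obtain ⟨ρ, hρ, support⟩ := bounded_support.exists_pos_norm_le
  obtain ⟨R, hw⟩ := hS.eventually_admissibleWindow lipschitz nonneg le_one hρ
    (fun u hu => support u ((nonneg u).lt_of_ne' hu)) one_le_bandwidth hΔ
  have hmesh := hS.tendsto_meshSize_nhdsGT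
  obtain ⟨β, hβ, bias_le⟩ := hC.exists_eventually_hsNorm_bias_le hmesh hw hΘ
  obtain ⟨v, hv, fluctuation_le⟩ :=
    hX.exists_eventually_rootMeanSquare_fluctuation_le hC hmesh hρ.le hw
  refine ⟨2 * (v + β), ?_⟩
  filter_upwards [bias_le, fluctuation_le] with n bias_le fluctuation_le θ hθ
  rw [density_eq]
  calc _ ≤ _ := rootMeanSquare_compress_estimator_sub_le (norm_le_one n) θ
    _ ≤ _ := mul_le_mul_right (add_le_add (fluctuation_le θ) (bias_le θ hθ)) 2
    _ ≤ _ := two_mul_ofReal_add_le hv hβ (Real.sqrt_nonneg _) (add_nonneg (add_nonneg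
      (Real.rpow_nonneg (meshSize_nonneg _) γ) ENNReal.toReal_nonneg) ENNReal.toReal_nonneg)

theorem mainTheorem10
    {d : ℕ}
    {E : Type*} [TopologicalSpace E] [CompactSpace E]
    {H : Type*} [NormedAddCommGroup H] [InnerProductSpace ℂ H] [CompleteSpace H]
    [TopologicalSpace.SeparableSpace H] [MeasurableSpace H] [BorelSpace H]
    [RKHS ℂ H E ℂ]
    (hR : Continuous fun p : E × E => reproducingKernel H p.1 p.2)
    {ι : Type*} (b : HilbertBasis ι ℂ H)
    {Ω : Type*} [MeasurableSpace Ω] (P : Measure Ω) [IsProbabilityMeasure P]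
    (X : EuclideanSpace ℝ (Fin d) → Ω → H) (hX : IsStationaryGaussian P b X)
    (γ : ℝ) (hC : CovarianceRegular b (autocov P X) γ)
    (K : EuclideanSpace ℝ (Fin d) → ℝ) (hK : KernelRegular K)
    (S : ℕ → Finset (EuclideanSpace ℝ (Fin d))) (hS : SamplingDesign S)
    (m : ℕ → ℕ) (u : ∀ n, Fin (m n) → E)
    (hu : ∀ n, IsUnit (kernelMatrix H (u n)))
    (Δ : ℕ → ℝ) (hΔ : Tendsto Δ atTop atTop)
    (hΔS : ∀ᶠ n in atTop, Δ n • kernelSupport K ⊆ region (S n) - region (S n))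
    (hΔvol : Tendsto (fun n => Δ n ^ d / volume.real (region (S n))) atTop (𝓝 0)) :
    (∀ n θ, spectralDensity (autocov P fun t ω => observationProjection H (u n) (X t ω)) θ =
      compress (observationProjection H (u n)) (spectralDensity (autocov P X) θ)) ∧
    ∀ Θ : Set (EuclideanSpace ℝ (Fin d)), Bornology.IsBounded Θ →
      ∃ c : ℝ, ∀ᶠ n in atTop, ∀ θ ∈ Θ,
        rootMeanSquare P b (fun ω =>
          compress (observationProjection H (u n)) (estimator X (S n) K (Δ n) θ ω) -
            spectralDensity (autocov P fun t ω' => observationProjection H (u n) (X t ω')) θ) ≤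
        ENNReal.ofReal (c * (meshSize (S n) ^ γ +
          biasB1 b (autocov P X) K (Δ n) θ + biasB2 b (autocov P X) K (Δ n) θ +
          √(Δ n ^ d / volume.real (region (S n))))) := by
  obtain ⟨L, lipschitz⟩ := hK.lipschitz
  exact mainTheorem10_general b P X hX γ hC K hK.nonneg hK.le_one hK.bounded_support L lipschitz
    S hS (fun n => observationProjection H (u n)) (fun _ => isSelfAdjoint_starProjection _)
    (fun _ => Submodule.starProjection_norm_le _) Δ (hΔ.eventually_ge_atTop 1) hΔvol
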